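/- Let $K$ be a field, $S=K[x_0,\dots,x_n]$ with $x_0<\dots<x_n$, and let $J\subseteq S$ be a strongly stable monomial ideal that is an $m$-truncation for some $m\in\mathbb N$, that is $J=(J^{\mathrm{sat}})_{\ge m}$. (Strongly stable: if $x^\alpha\in J$, $x_i\mid x^\alpha$ and $i<j$, then $x^\alpha x_j/x_i\in J$.) **Notation.** $B_J$ is the set of minimal monomial generators of $J$; $\mathcal N(J)$ is the set of monomials outside $J$, and $\mathcal N(J)_d$ its part of degree $d$. $x^{\underline\alpha}$ is $x^\alpha$ with $x_0$ replaced by $1$; $\underline J$ is the ideal generated by the $x^{\underline\alpha}$, $x^\alpha\in B_J$; $sB_J=\{x^\alpha\in B_J : x^{\underline\alpha}\in B_{\underline J}\}$ is the set of superminimal generators. For a monomial ideal $I$ write $x^\gamma=x^\alpha *_I x^\eta$ if $x^\gamma=x^\alpha x^\eta$, $x^\alpha\in B_I$ and every variable dividing $x^\eta$ is $\le$ every variable dividing $x^\alpha$. $\mathrm{Mf}(J)$ is the set of homogeneous ideals $I\subseteq S$ such that $\mathcal N(J)$ is a $K$-basis of $S/I$. Let $C=\{C_{\alpha\gamma} :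 x^\alpha\in B_J,\ x^\gamma\in\mathcal N(J)_{|\alpha|}\}$ be new variables, $\widetilde C\subseteq C$ those with $x^\alpha\in sB_J$, $F_\alpha=x^\alpha-\sum_\gamma C_{\alpha\gamma}x^\gamma$ with head term $x^\alpha$, $\mathcal G=\{F_\alpha : x^\alpha\in B_J\}$ and $s\mathcal G=\{F_\alpha : x^\alpha\in sB_J\}$. With $\mathrm{lcm}(x^\alpha,x^{\alpha'})=x^\gamma x^\alpha=x^{\gamma'}x^{\alpha'}$ put $S(F_\alpha,F_{\alpha'})=x^\gamma F_\alpha-x^{\gamma'}F_{\alpha'}$. Let $\mathfrak A_J\subseteq K[C]$ be the ideal generated by the $x$-coefficients of the reduced forms (all $x$-monomials in $\mathcal N(J)$) of the polynomials $S(F,F')$, $F,F'\in\mathcal G$, obtained by reduction with the polynomials $x^\delta F_\alpha$, $F_\alpha\in\mathcal G$, such that every variable dividing $x^\delta$ is $\le$ every variable dividing $x^\alpha$; it defines the scheme structure of $\mathrm{Mf}(J)$. Put $\widetilde{\mathfrak A}_J=\mathfrak A_J\cap K[\widetilde C]$. A step of *superminimal reduction* of $h\in K[\widetilde C][x]$ replaces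 $h$ by $h-c\,x^\epsilon F_\alpha$, where $F_\alpha\in s\mathcal G$, $x^\gamma=x^\alpha x^\epsilon\in J$ is a monomial of $h$ with coefficient $c\ne0$, and $x^\gamma=x^{\underline\alpha}*_{\underline J}x^\eta$ for some $x^\eta$. $h$ is *strongly reduced* if no $x_0^th$, $t\ge0$, admits such a step. $\textsc{superminimalReduction}(H)$ returns $(t,h)$, where $t$ is minimal such that zero or more steps lead from $x_0^tH$ to a strongly reduced polynomial, and $h$ is such a polynomial; it is executed by trying $t=0,1,2,\dots$, performing for each $t$ arbitrary steps on $x_0^tH$ until none is possible, and stopping as soon as a strongly reduced polynomial is reached. **The algorithm markedScheme$(J)$.** (0) Build $s\mathcal G$ and let $\widetilde{\mathcal G}=s\mathcal G$, $E=\emptyset$. (1) For every $x^\alpha\in B_J\setminus sB_J$, let $(t,H)=\textsc{superminimalReduction}(x^\alpha)$, write $H=H'+x_0^tH''$ with no monomial of $H'$ divisible by $x_0^t$, add the $x$-coefficients of $H'$ to $E$ and $x^\alpha-H''$ to $\widetilde{\mathcal G}$. (2) For every pair in $$L_1=\{(F_\alpha,F_{\alpha'}) : F_\alpha,F_{\alpha'}\in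 s\mathcal G,\ x_ix^{\underline\alpha}=x^{\underline{\alpha'}}*_{\underline J}x^\eta\text{ for some } i \text{ and } x^\eta\},$$ let $(t,H)=\textsc{superminimalReduction}(S(F_\alpha,F_{\alpha'}))$ and add the $x$-coefficients of $H$ to $E$. Return $E\subseteq K[\widetilde C]$. **Theorem.** The algorithm is correct. For every order in which the loops are processed and every choice of the reduction steps, it terminates (there is no infinite run, and a run stops only by returning), each of its calls of $\textsc{superminimalReduction}$ ends with a pair as prescribed above, and the returned set $E$ is finite and generates $\widetilde{\mathfrak A}_J$. This ideal defines $\mathrm{Mf}(J)$: the inclusion $K[\widetilde C]\subseteq K[C]$ induces a surjection $K[\widetilde C]\to K[C]/\mathfrak A_J$ (hence $K[\widetilde C]/\widetilde{\mathfrak A}_J\cong K[C]/\mathfrak A_J$); for every zero $c\in K^{\widetilde C}$ of $\widetilde{\mathfrak A}_J$ there is exactly one $I\in\mathrm{Mf}(J)$ that contains all the specializations $F_\alpha(c)$, $F_\alpha\in s\mathcal G$; and every $I\in\mathrm{Mf}(J)$ arises in this way from exactly one zero $c$ of $\widetilde{\mathfrak A}_J$. -/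

import Mathlib

open MvPolynomial

noncomputable section

namespace MarkedScheme

/-- Exponents of the monomials in the variables `x_0 < x_1 < ... < x_n`. -/
abbrev Exp (n : ℕ) := Fin (n + 1) →₀ ℕ

/-- Polynomials in `x_0, ..., x_n` with coefficients in `A`. -/
abbrev Poly (n : ℕ) (A : Type*) [CommRing A] := MvPolynomial (Fin (n + 1)) A

section MonomialIdeals

variable {n : ℕ} {K : Type*} [Field K]

/-- `J` is generated by monomials. -/
def IsMonomialIdeal (J : Ideal (Poly n K)) : Prop :=
  ∃ s : Set (Exp n), J = Ideal.span ((fun α => monomial α (1 : K)) '' s)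

/-- `x^β = e⁺_{i,j}(x^α)` for some `i < j`, that is `x^α x_j = x^β x_i`. -/
def IncreasingMove (α β : Exp n) : Prop :=
  ∃ i j : Fin (n + 1), i < j ∧ α + Finsupp.single j 1 = β + Finsupp.single i 1

/-- `BorelLT α β` means `x^α <_B x^β` in the Borel partial order. -/
def BorelLT (α β : Exp n) : Prop := Relation.TransGen IncreasingMove α β

/-- Every monomial that is Borel-greater than a monomial of `J` belongs to `J`. -/
def IsStronglyStable (J : Ideal (Poly n K)) : Prop :=
  ∀ α β : Exp n, monomial α (1 : K) ∈ J → BorelLT α β → monomial β (1 : K) ∈ J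

/-- The saturation of `J` with respect to the irrelevant ideal. -/
def saturation (J : Ideal (Poly n K)) : Set (Poly n K) :=
  {f | ∀ j : Fin (n + 1), ∃ r : ℕ, X j ^ r * f ∈ J}

/-- `J = (J^sat)_{≥ m}`. -/
def IsTruncation (m : ℕ) (J : Ideal (Poly n K)) : Prop :=
  ∀ f : Poly n K, f ∈ J ↔ f ∈ saturation J ∧ ∀ γ ∈ f.support, m ≤ γ.degree

/-- The minimal monomial generators `B_J` of a monomial ideal. -/
def monomialBasis (J : Ideal (Poly n K)) : Set (Exp n) :=
  {α | monomial α (1 : K) ∈ J ∧ ∀ β : Exp n, monomial β (1 : K) ∈ J → β ≤ α → β = α}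

/-- The sous-escalier `N(J)`: the monomials outside `J`. -/
def sousEscalier (J : Ideal (Poly n K)) : Set (Exp n) :=
  {γ | monomial γ (1 : K) ∉ J}

open Classical in
/-- `N(J)_d`, the monomials of degree `d` outside `J`. -/
def sousEscalierDeg (J : Ideal (Poly n K)) (d : ℕ) : Finset (Exp n) :=
  (Finset.finsuppAntidiag Finset.univ d).filter (fun γ => γ ∈ sousEscalier J)

/-- The exponent of the monomial obtained from `x^α` by putting `x_0 = 1`. -/
def under (α : Exp n) : Exp n := α.erase 0

/-- The ideal generated by the monomials of `B_J` after putting `x_0 = 1`. -/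
def underIdeal (J : Ideal (Poly n K)) : Ideal (Poly n K) :=
  Ideal.span ((fun α => monomial (under α) (1 : K)) '' monomialBasis J)

/-- The superminimal generators `sB_J`. -/
def superminimals (J : Ideal (Poly n K)) : Set (Exp n) :=
  {β | β ∈ monomialBasis J ∧ under β ∈ monomialBasis (underIdeal J)}

/-- `x^γ = x^α *_J x^η`: `x^γ = x^α x^η`, `x^α ∈ B_J` and `min(x^α) ≥ max(x^η)`
(the last condition being void when `x^α = 1` or `x^η = 1`). -/
def IsStar (J : Ideal (Poly n K)) (γ α η : Exp n) : Prop :=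
  γ = α + η ∧ α ∈ monomialBasis J ∧ ∀ i ∈ α.support, ∀ j ∈ η.support, j ≤ i

/-- The marked family `Mf(J)`: the homogeneous ideals `I` such that the monomials outside `J`
form a `K`-basis of the quotient by `I`. -/
def markedFamily (J : Ideal (Poly n K)) : Set (Ideal (Poly n K)) :=
  {I | (∀ f ∈ I, ∀ d : ℕ, homogeneousComponent d f ∈ I) ∧
    LinearIndependent K
      (fun γ : sousEscalier J => Ideal.Quotient.mk I (monomial (γ : Exp n) (1 : K))) ∧
    Submodule.span K (Set.range
      (fun γ : sousEscalier J => Ideal.Quotient.mk I (monomial (γ : Exp n) (1 : K)))) = ⊤}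

end MonomialIdeals

/-- A polynomial together with (the exponent of) its head term. -/
structure Marked (n : ℕ) (A : Type*) [CommRing A] where
  head : Exp n
  poly : Poly n A

section Reductions

variable {n : ℕ} {K : Type*} [Field K] {A : Type*} [CommRing A]

/-- The S-polynomial of two marked polynomials. -/
def sPoly (f g : Marked n A) : Poly n A :=
  monomial ((f.head ⊔ g.head) - f.head) 1 * f.poly -
    monomial ((f.head ⊔ g.head) - g.head) 1 * g.poly

/-- All monomials of `h` lie outside `J`. -/
def IsReduced (J : Ideal (Poly n K)) (h : Poly n A) : Prop :=
  ∀ γ ∈ h.support, γ ∈ sousEscalier J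

/-- One step of reduction by the set `V` of the polynomials `x^δ f_α` with `f_α ∈ G` and
`x^δ = 1` or `max(x^δ) ≤ min(x^α)`. -/
def VStep (G : Set (Marked n A)) (h h₁ : Poly n A) : Prop :=
  ∃ f ∈ G, ∃ δ : Exp n, (∀ i ∈ f.head.support, ∀ j ∈ δ.support, j ≤ i) ∧
    δ + f.head ∈ h.support ∧
    h₁ = h - monomial δ (h.coeff (δ + f.head)) * f.poly

/-- The `sG_*`-relation: a monomial `x^γ ∈ Supp(h) ∩ J` with coefficient `c`,
`x^γ = x^{under α} *_{underIdeal J} x^η = x^α x^ε`, is eliminated by subtracting `c x^ε f_α`. -/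
def SGStep (J : Ideal (Poly n K)) (sG : Set (Marked n A)) (h h₁ : Poly n A) : Prop :=
  ∃ γ ∈ h.support, monomial γ (1 : K) ∈ J ∧
    ∃ f ∈ sG, ∃ η ε : Exp n, IsStar (underIdeal J) γ (under f.head) η ∧ γ = f.head + ε ∧
      h₁ = h - monomial ε (h.coeff γ) * f.poly

/-- Superminimal reduction (zero or more steps). -/
def SGReduces (J : Ideal (Poly n K)) (sG : Set (Marked n A)) : Poly n A → Poly n A → Prop :=
  Relation.ReflTransGen (SGStep J sG)

/-- No step of superminimal reduction can be performed on `h`. -/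
def NonReducible (J : Ideal (Poly n K)) (sG : Set (Marked n A)) (h : Poly n A) : Prop :=
  ∀ h₁, ¬ SGStep J sG h h₁

/-- No `x_0^t h` can be reduced. -/
def StronglyReduced (J : Ideal (Poly n K)) (sG : Set (Marked n A)) (h : Poly n A) : Prop :=
  ∀ t : ℕ, NonReducible J sG (X 0 ^ t * h)

/-- The specification of `superminimalReduction(H, sG) = (t, h)`: `t` is the least exponent such
that `x_0^t H` has a superminimal reduction to a strongly reduced polynomial, and `h` is such a
polynomial. -/
def IsSuperminimalReduction (J : Ideal (Poly n K)) (sG : Set (Marked n A)) (H : Poly n A)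
    (t : ℕ) (h : Poly n A) : Prop :=
  SGReduces J sG (X 0 ^ t * H) h ∧ StronglyReduced J sG h ∧
    ∀ t' : ℕ, ∀ h' : Poly n A, SGReduces J sG (X 0 ^ t' * H) h' → StronglyReduced J sG h' → t ≤ t'

/-- One step of the execution of `superminimalReduction(H, sG)`. The pair `(t, P)` consists of the
current exponent and of a polynomial to which `x_0^t H` has been reduced: an arbitrary reduction
step is performed on `P` as long as possible; if the outcome is not strongly reduced, the
computation is started again with `t + 1`. The execution ends at `(t, P)` when `P` is strongly
reduced. -/
inductive SMRStep (J : Ideal (Poly n K)) (sG : Set (Marked n A)) (H : Poly n A) :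
    ℕ × Poly n A → ℕ × Poly n A → Prop
  | reduce (t : ℕ) (P P' : Poly n A) (h : SGStep J sG P P') : SMRStep J sG H (t, P) (t, P')
  | restart (t : ℕ) (P : Poly n A) (h : NonReducible J sG P) (h' : ¬ StronglyReduced J sG P) :
      SMRStep J sG H (t, P) (t + 1, X 0 ^ (t + 1) * H)

/-- The set `L_1`: the pairs of elements of `sG` such that
`x_i x^{under α} = x^{under α'} *_{underIdeal J} x^η` for some `i` and some `η`. -/
def pairsL1 (J : Ideal (Poly n K)) (sG : Set (Marked n A)) : Set (Marked n A × Marked n A) :=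
  {p | p.1 ∈ sG ∧ p.2 ∈ sG ∧ ∃ (i : Fin (n + 1)) (η : Exp n),
    IsStar (underIdeal J) (Finsupp.single i 1 + under p.1.head) (under p.2.head) η}

end Reductions

section Generic

variable {n : ℕ} {K : Type*} [Field K]

/-- The indices `(α, γ)` of the parameters `C_{αγ}`, with `x^α ∈ B` and `x^γ ∈ N(J)_{|α|}`. -/
def Param (J : Ideal (Poly n K)) (B : Set (Exp n)) : Type :=
  {p : Exp n × Exp n // p.1 ∈ B ∧ p.2 ∈ sousEscalierDeg J p.1.degree}

/-- The parameters `C`. -/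
abbrev ParamC (J : Ideal (Poly n K)) : Type := Param J (monomialBasis J)

/-- The parameters `C̃`. -/
abbrev ParamCt (J : Ideal (Poly n K)) : Type := Param J (superminimals J)

/-- The inclusion of `C̃` in `C`. -/
def inclParam (J : Ideal (Poly n K)) (c : ParamCt J) : ParamC J :=
  ⟨c.1, c.2.1.1, c.2.2⟩

/-- The generic marked polynomial `F_α = x^α - ∑ C_{αγ} x^γ`, the sum being over `N(J)_{|α|}`. -/
def generic (J : Ideal (Poly n K)) (B : Set (Exp n)) (α : Exp n) (hα : α ∈ B) :
    Marked n (MvPolynomial (Param J B) K) where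
  head := α
  poly := monomial α 1 -
    ∑ γ ∈ (sousEscalierDeg J α.degree).attach, monomial γ.1 (X ⟨(α, γ.1), hα, γ.2⟩)

/-- The set of the `F_α` with `x^α ∈ B`; it is `𝒢` for `B = B_J` and `s𝒢` for `B = sB_J`. -/
def genericSet (J : Ideal (Poly n K)) (B : Set (Exp n)) :
    Set (Marked n (MvPolynomial (Param J B) K)) :=
  {F | ∃ (α : Exp n) (hα : α ∈ B), F = generic J B α hα}

/-- The ideal `𝔄_J` of `K[C]`, generated by the `x`-coefficients of the `J`-reduced forms,
obtained by `V`-reduction, of the S-polynomials of the elements of `𝒢`; it defines the scheme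
structure of `Mf(J)`. -/
def idealA (J : Ideal (Poly n K)) : Ideal (MvPolynomial (ParamC J) K) :=
  Ideal.span {c | ∃ F ∈ genericSet J (monomialBasis J), ∃ F' ∈ genericSet J (monomialBasis J),
    ∃ R, Relation.ReflTransGen (VStep (genericSet J (monomialBasis J))) (sPoly F F') R ∧
      IsReduced J R ∧ c ∈ R.coeffs}

/-- The inclusion `K[C̃] → K[C]`. -/
def inclRing (J : Ideal (Poly n K)) :
    MvPolynomial (ParamCt J) K →ₐ[K] MvPolynomial (ParamC J) K :=
  rename (inclParam J)

/-- The ideal `𝔄̃_J = 𝔄_J ∩ K[C̃]`. -/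
def idealAt (J : Ideal (Poly n K)) : Ideal (MvPolynomial (ParamCt J) K) :=
  (idealA J).comap (inclRing J)

/-- The specialization at `c : C̃ → K` of a polynomial of `K[C̃][x]`. -/
def specialize {J : Ideal (Poly n K)} (c : ParamCt J → K)
    (f : Poly n (MvPolynomial (ParamCt J) K)) : Poly n K :=
  MvPolynomial.map (MvPolynomial.eval c) f

end Generic

section Algorithm

variable {n : ℕ} {K : Type*} [Field K]

/-- The coefficient ring `K[C̃]`. -/
abbrev Coef (J : Ideal (Poly n K)) := MvPolynomial (ParamCt J) K

/-- The program points of the algorithm `markedScheme`; `todo` is the set of the elements that the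
current loop has still to process. -/
inductive Control (J : Ideal (Poly n K))
  /-- head of the loop over `sB_J` that builds `s𝒢` -/
  | build (todo : Set (Exp n))
  /-- head of the loop over `B_J \ sB_J` -/
  | loopGens (todo : Set (Exp n))
  /-- inside the call `superminimalReduction(x^α, s𝒢)` -/
  | callGen (todo : Set (Exp n)) (α : Exp n) (t : ℕ) (P : Poly n (Coef J))
  /-- head of the loop over `L_1` -/
  | loopPairs (todo : Set (Marked n (Coef J) × Marked n (Coef J)))
  /-- inside the call `superminimalReduction(S(F, F'), s𝒢)` -/
  | callPair (todo : Set (Marked n (Coef J) × Marked n (Coef J)))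
      (p : Marked n (Coef J) × Marked n (Coef J)) (t : ℕ) (P : Poly n (Coef J))
  /-- the algorithm has returned -/
  | returned

/-- The states of the algorithm `markedScheme`: the variables `𝒢̃`, `s𝒢`, `equations` and the
program point. -/
structure State (J : Ideal (Poly n K)) where
  Gt : Set (Marked n (Coef J))
  sG : Set (Marked n (Coef J))
  eqs : Set (Coef J)
  ctrl : Control J

/-- The initial state. -/
def initState (J : Ideal (Poly n K)) : State J :=
  ⟨∅, ∅, ∅, .build (superminimals J)⟩

/-- The steps of the algorithm `markedScheme`. The loops process their elements in arbitrary
order. For `H = H' + x_0^t H''`, with no monomial of `H'` divisible by `x_0^t`, the remainder `H'`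
is `H.modMonomial (Finsupp.single 0 t)` and the quotient `H''` is
`H.divMonomial (Finsupp.single 0 t)`. -/
inductive Step (J : Ideal (Poly n K)) : State J → State J → Prop
  | build (Gt sG eqs todo) (α : Exp n) (hα : α ∈ superminimals J) (h : α ∈ todo) :
      Step J ⟨Gt, sG, eqs, .build todo⟩
        ⟨insert (generic J (superminimals J) α hα) Gt,
          insert (generic J (superminimals J) α hα) sG, eqs, .build (todo \ {α})⟩
  | buildDone (Gt sG eqs) :
      Step J ⟨Gt, sG, eqs, .build ∅⟩
        ⟨Gt, sG, eqs, .loopGens (monomialBasis J \ superminimals J)⟩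
  | genCall (Gt sG eqs todo) (α : Exp n) (h : α ∈ todo) :
      Step J ⟨Gt, sG, eqs, .loopGens todo⟩
        ⟨Gt, sG, eqs, .callGen (todo \ {α}) α 0 (monomial α 1)⟩
  | genWork (Gt sG eqs todo) (α : Exp n) (t t' : ℕ) (P P' : Poly n (Coef J))
      (h : SMRStep J sG (monomial α 1) (t, P) (t', P')) :
      Step J ⟨Gt, sG, eqs, .callGen todo α t P⟩ ⟨Gt, sG, eqs, .callGen todo α t' P'⟩
  | genReturn (Gt sG eqs todo) (α : Exp n) (t : ℕ) (H : Poly n (Coef J))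
      (h : StronglyReduced J sG H) :
      Step J ⟨Gt, sG, eqs, .callGen todo α t H⟩
        ⟨insert ⟨α, monomial α 1 - H.divMonomial (Finsupp.single 0 t)⟩ Gt, sG,
          eqs ∪ (H.modMonomial (Finsupp.single 0 t)).coeffs, .loopGens todo⟩
  | gensDone (Gt sG eqs) :
      Step J ⟨Gt, sG, eqs, .loopGens ∅⟩ ⟨Gt, sG, eqs, .loopPairs (pairsL1 J sG)⟩
  | pairCall (Gt sG eqs todo) (p : Marked n (Coef J) × Marked n (Coef J)) (h : p ∈ todo) :
      Step J ⟨Gt, sG, eqs, .loopPairs todo⟩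
        ⟨Gt, sG, eqs, .callPair (todo \ {p}) p 0 (sPoly p.1 p.2)⟩
  | pairWork (Gt sG eqs todo) (p : Marked n (Coef J) × Marked n (Coef J)) (t t' : ℕ)
      (P P' : Poly n (Coef J)) (h : SMRStep J sG (sPoly p.1 p.2) (t, P) (t', P')) :
      Step J ⟨Gt, sG, eqs, .callPair todo p t P⟩ ⟨Gt, sG, eqs, .callPair todo p t' P'⟩
  | pairReturn (Gt sG eqs todo) (p : Marked n (Coef J) × Marked n (Coef J)) (t : ℕ)
      (H : Poly n (Coef J)) (h : StronglyReduced J sG H) :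
      Step J ⟨Gt, sG, eqs, .callPair todo p t H⟩
        ⟨Gt, sG, eqs ∪ H.coeffs, .loopPairs todo⟩
  | pairsDone (Gt sG eqs) :
      Step J ⟨Gt, sG, eqs, .loopPairs ∅⟩ ⟨Gt, sG, eqs, .returned⟩

/-- The states that occur in the runs of the algorithm. -/
def Reachable (J : Ideal (Poly n K)) (s : State J) : Prop :=
  Relation.ReflTransGen (Step J) (initState J) s

end Algorithm

end MarkedScheme

end

open MarkedScheme

/-! The proof compares points over arbitrary rings `A`. A marked family over `A` is a marked basis
when its ideal contains no nonzero polynomial supported outside `J`. The specializations `K[C] → A`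
that kill `𝔄_J` are those that turn `𝒢` into a marked basis
(`IsMarkedBasis.map_eq_zero_of_mem_idealA`, `isMarkedBasis_of_map_idealA`). Over `K[C]/𝔄_J`,
uniqueness of reduced forms forces every strong reduct of `x_0^t x^α` to be `x_0^t (x^α - F_α)` and
those of S-polynomials to vanish. Hence all equations found lie in `𝔄̃_J`, and every `C_{αγ}` is the
class of a polynomial in `C̃`. Conversely, a specialization of `C̃` that kills the equations extends
to a marked basis (`KillsEquations.exists_isMarkedBasis`), hence kills `𝔄̃_J`; for `A = K[C̃]/(E)`
this is the other inclusion, and `A = K` gives the points of `Mf(J)`.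

Both reductions are instances of one mechanism, `IsSystem`, with `u = id` for reduction by `𝒢` and
`u = under` for superminimal reduction. In a strongly stable ideal every monomial has a unique star
decomposition, and if `x^δ` is outside the ideal, then the tail of `x^ε x^δ` is colex-smaller than
`ε` (`IsStar.tail_lt`). So reduction is triangular for the rank: it terminates, its normal forms are
unique, and a Buchberger criterion needs only the pairs that come from star decompositions of `x_j
x^α` (`IsSystem.monomial_mul_mem_satSpan`). The truncation hypothesis says that `J` is the part of
degree at least `m` of `underIdeal J`; in these degrees avoiding `J` and avoiding `underIdeal J`
agree, and powers of `x_0` do not matter for the latter.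

A call of superminimal reduction stops because some `x_0^T H` has a strongly reduced form; by
uniqueness, every complete reduction of `x_0^T H` is then strongly reduced. -/

noncomputable section

namespace MarkedScheme

/-! ### Star decompositions, the colex order on tails, and setting `x_0 = 1`. -/

section Combinatorics

variable {n : ℕ} {K : Type*} [Field K]

theorem monomial_mem_of_le {I : Ideal (Poly n K)} {α β : Exp n}
    (h : monomial α (1 : K) ∈ I) (hle : α ≤ β) : monomial β (1 : K) ∈ I := by
  have : monomial β (1 : K) = monomial (β - α) 1 * monomial α 1 := by
    rw [monomial_mul, tsub_add_cancel_of_le hle, one_mul]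
  rw [this]
  exact I.mul_mem_left _ h

theorem exists_monomialBasis_le {I : Ideal (Poly n K)} {γ : Exp n}
    (h : monomial γ (1 : K) ∈ I) : ∃ α ∈ monomialBasis I, α ≤ γ := by
  induction γ using WellFoundedLT.induction with
  | ind γ ih =>
    by_cases hγ : γ ∈ monomialBasis I
    · exact ⟨γ, hγ, le_rfl⟩
    · simp only [monomialBasis, Set.mem_ofPred_eq, not_and, not_forall] at hγ
      obtain ⟨β, hβ, hle, hne⟩ := hγ h
      obtain ⟨α, hα, hαβ⟩ := ih β (lt_of_le_of_ne hle hne) hβ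
      exact ⟨α, hα, hαβ.trans hle⟩

theorem monomialBasis_finite (I : Ideal (Poly n K)) : (monomialBasis I).Finite := by
  apply WellQuasiOrderedLE.finite_of_isAntichain
  intro α hα β hβ hne hle
  exact hne (hβ.2 α hα.1 hle)

/-- At the largest index `i` where `η` and `ε` differ, `η` has the larger exponent. Above `i` the
exponents of `α` and `δ` agree, at `i` that of `δ` is larger, and below `i` that of `α` is zero
because `x_i` divides the tail `x^η`. -/
theorem le_of_not_colex_lt {α η ε δ : Exp n} (heq : α + η = ε + δ)
    (hst : ∀ i ∈ α.support, ∀ j ∈ η.support, j ≤ i) (hlt : ¬ toColex η < toColex ε) :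
    α ≤ δ := by
  have hc : ∀ i, α i + η i = ε i + δ i := fun i => by
    have := DFunLike.congr_fun heq i
    simpa using this
  rcases (not_lt.1 hlt).lt_or_eq with h | h
  · rw [Finsupp.Colex.lt_iff] at h
    obtain ⟨i, hi, hlt⟩ := h
    simp only [ofColex_toColex] at hi hlt
    intro j
    rcases lt_trichotomy j i with hj | rfl | hj
    · have : α j = 0 := by
        by_contra hne
        have := hst j (by simpa using hne) i (by simp; omega)
        exact absurd this (not_le.2 hj)
      omega
    · have := hc j
      omega
    · have := hc j
      have := hi j hj
      omega
  · have h' : ε = η := by simpa using h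
    subst h'
    intro j
    have := hc j
    omega

theorem IsStar.mem {I : Ideal (Poly n K)} {γ α η : Exp n} (h : IsStar I γ α η) :
    monomial γ (1 : K) ∈ I :=
  monomial_mem_of_le h.2.1.1 (h.1 ▸ le_self_add)

/-- The source of all termination and triangularity statements: replacing a head by monomials
outside `I` lowers the tail. Otherwise the generator `x^α` would divide `x^δ`. -/
theorem IsStar.tail_lt {I : Ideal (Poly n K)} {δ ε α η : Exp n}
    (hδ : monomial δ (1 : K) ∉ I) (h : IsStar I (ε + δ) α η) : toColex η < toColex ε := by
  by_contra hlt
  exact hδ (monomial_mem_of_le h.2.1.1 (le_of_not_colex_lt h.1.symm h.2.2 hlt))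

/-- The generator whose tail is not colex-smaller divides the other generator, so minimality makes
them equal. -/
theorem IsStar.unique {I : Ideal (Poly n K)} {γ α η α' η' : Exp n}
    (h : IsStar I γ α η) (h' : IsStar I γ α' η') : α = α' ∧ η = η' := by
  have key : α = α' := by
    by_cases hlt : toColex η < toColex η'
    · exact h.2.1.2 _ h'.2.1.1 (le_of_not_colex_lt (ε := η) (δ := α)
        (by rw [← h'.1, h.1, add_comm]) h'.2.2 hlt.not_gt) |>.symm
    · exact h'.2.1.2 _ h.2.1.1 (le_of_not_colex_lt (ε := η') (δ := α')
        (by rw [← h.1, h'.1, add_comm]) h.2.2 hlt)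
  subst key
  exact ⟨rfl, add_left_cancel (h.1.symm.trans h'.1)⟩

/-- Otherwise the new generator divides `x^α`, hence equals it, and the tail is `x_j`; the star
condition then fails because `x_i` divides `x^α` and `i < j`. -/
theorem IsStar.tail_lt_single {I : Ideal (Poly n K)} {α α' η : Exp n} {i j : Fin (n + 1)}
    (hα : α ∈ monomialBasis I) (hi : i ∈ α.support) (hij : i < j)
    (h : IsStar I (Finsupp.single j 1 + α) α' η) :
    toColex η < toColex (Finsupp.single j 1) := by
  by_contra hlt
  have := hα.2 _ h.2.1.1 (le_of_not_colex_lt h.1.symm h.2.2 hlt)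
  subst this
  have hη : η = Finsupp.single j 1 := add_left_cancel (h.1.symm.trans (add_comm _ _))
  exact absurd (h.2.2 i hi j (by simp [hη])) (not_le.2 hij)

/-- Every monomial of `I` has a star decomposition. -/
def HasStars (I : Ideal (Poly n K)) : Prop :=
  ∀ γ : Exp n, monomial γ (1 : K) ∈ I → ∃ α η, IsStar I γ α η

/-- A monomial of `I` that is not a generator can be divided by some `x_i` within `I`; by strong
stability it can then also be divided by its least variable `x_k`, since this only trades `x_k` for
`x_i`. By induction the quotient has a star decomposition, and `x_k` joins the tail. -/
theorem IsStronglyStable.hasStars {I : Ideal (Poly n K)} (hI : IsStronglyStable I) :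
    HasStars I := by
  intro γ hγ
  induction γ using WellFoundedLT.induction with
  | ind γ ih =>
    by_cases hb : γ ∈ monomialBasis I
    · exact ⟨γ, 0, by simp, hb, by simp⟩
    obtain ⟨α, hα, hle⟩ := exists_monomialBasis_le hγ
    have hne : α ≠ γ := fun h => hb (h ▸ hα)
    obtain ⟨i, hi⟩ : ∃ i, α i < γ i := by
      by_contra! hcon
      exact hne (le_antisymm hle hcon)
    have hγi : γ i ≠ 0 := by omega
    have hne : γ.support.Nonempty := ⟨i, by simpa using hγi⟩
    set k := γ.support.min' hne with hk
    have hkm : γ k ≠ 0 := by simpa using γ.support.min'_mem hne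
    have hki : k ≤ i := Finset.min'_le _ _ (by simpa using hγi)
    have hcancel : ∀ l, γ l ≠ 0 → γ - Finsupp.single l 1 + Finsupp.single l 1 = γ := by
      intro l hl
      apply tsub_add_cancel_of_le
      rw [Finsupp.single_le_iff]
      omega
    have h1 : monomial (γ - Finsupp.single i 1) (1 : K) ∈ I := by
      refine monomial_mem_of_le hα.1 fun l => ?_
      have := hle l
      by_cases hl : l = i
      · subst hl; simp; omega
      · simp [Ne.symm hl, this]
    have h2 : monomial (γ - Finsupp.single k 1) (1 : K) ∈ I := by
      rcases hki.eq_or_lt with h | h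
      · rwa [h]
      · refine hI _ _ h1 (Relation.TransGen.single ⟨k, i, h, ?_⟩)
        rw [hcancel i hγi, hcancel k hkm]
    obtain ⟨α', η, hst⟩ := ih _ (by
      refine lt_of_le_of_ne tsub_le_self fun h => ?_
      have := DFunLike.congr_fun h k
      simp at this
      omega) h2
    refine ⟨α', η + Finsupp.single k 1, ?_, hst.2.1, ?_⟩
    · rw [← add_assoc, ← hst.1, hcancel k hkm]
    · intro a ha b hb
      have hb' : b ∈ η.support ∨ b = k := by
        by_contra! hcon
        simp [Ne.symm hcon.2] at hb hcon
        exact hb hcon.1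
      rcases hb' with hb' | rfl
      · exact hst.2.2 a ha b hb'
      · refine Finset.min'_le _ _ ?_
        have := DFunLike.congr_fun hst.1 a
        simp at this ha ⊢
        omega

open Classical in
/-- The tail `η` of the star decomposition `x^γ = x^α *_I x^η`, and `⊥` if there is none. -/
def rank (I : Ideal (Poly n K)) (γ : Exp n) : WithBot (Colex (Exp n)) :=
  if h : ∃ η α, IsStar I γ α η then ((toColex h.choose : Colex (Exp n)) : WithBot _) else ⊥

theorem IsStar.rank_eq {I : Ideal (Poly n K)} {γ α η : Exp n} (h : IsStar I γ α η) :
    rank I γ = ((toColex η : Colex (Exp n)) : WithBot _) := by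
  have hex : ∃ η α, IsStar I γ α η := ⟨η, α, h⟩
  rw [rank, dif_pos hex]
  obtain ⟨α', h'⟩ := hex.choose_spec
  rw [(h.unique h').2]

theorem rank_add_lt {I : Ideal (Poly n K)} {ε δ : Exp n} (hδ : monomial δ (1 : K) ∉ I) :
    rank I (ε + δ) < ((toColex ε : Colex (Exp n)) : WithBot _) := by
  by_cases hex : ∃ η α, IsStar I (ε + δ) α η
  · obtain ⟨η, α, h⟩ := hex
    rw [h.rank_eq, WithBot.coe_lt_coe]
    exact h.tail_lt hδ
  · rw [rank, dif_neg hex]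
    exact WithBot.bot_lt_coe _

theorem under_apply (α : Exp n) (i : Fin (n + 1)) : under α i = if i = 0 then 0 else α i := by
  rw [under, Finsupp.erase_apply]

theorem under_apply_of_ne {α : Exp n} {i : Fin (n + 1)} (h : i ≠ 0) : under α i = α i := by
  rw [under_apply, if_neg h]

theorem under_le (α : Exp n) : under α ≤ α := fun i => by
  rw [under_apply]; split_ifs <;> simp

theorem under_add_single (α : Exp n) : under α + Finsupp.single 0 (α 0) = α := by
  rw [under, Finsupp.erase_add_single]

theorem forall_mem_support_monomial {P : Exp n → Prop} {γ : Exp n} :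
    (∀ δ ∈ (monomial γ (1 : K)).support, P δ) ↔ P γ := by
  classical
  simp [support_monomial]

/-- Identifies `underIdeal J`, on monomials, with the saturation of `J` by `x_0`. A suitable `t` is
the exponent of `x_0` in the generator used. -/
theorem under_mem_iff {J : Ideal (Poly n K)} {γ : Exp n} :
    monomial γ (1 : K) ∈ underIdeal J ↔
      ∃ t : ℕ, monomial (γ + Finsupp.single 0 t) (1 : K) ∈ J := by
  have : underIdeal J = Ideal.span ((fun β => monomial β (1 : K)) '' (under '' monomialBasis J)) := by
    rw [Set.image_image]; rfl
  rw [this, mem_ideal_span_monomial_image, forall_mem_support_monomial, Set.exists_mem_image]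
  constructor
  · rintro ⟨α, hα, hle⟩
    refine ⟨α 0, monomial_mem_of_le hα.1 ?_⟩
    calc α = under α + Finsupp.single 0 (α 0) := (under_add_single α).symm
      _ ≤ _ := by gcongr
  · rintro ⟨t, ht⟩
    obtain ⟨α, hα, hle⟩ := exists_monomialBasis_le ht
    refine ⟨α, hα, fun i => ?_⟩
    have := hle i
    rw [under_apply]
    split_ifs with h
    · exact Nat.zero_le _
    · simpa [Finsupp.single_apply, Ne.symm h] using this

theorem mem_underIdeal_of_mem {J : Ideal (Poly n K)} {γ : Exp n}
    (h : monomial γ (1 : K) ∈ J) : monomial γ (1 : K) ∈ underIdeal J :=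
  under_mem_iff.2 ⟨0, by simpa using h⟩

theorem under_add (α β : Exp n) : under (α + β) = under α + under β := Finsupp.erase_add _ _ _

theorem under_single_zero (t : ℕ) : under (Finsupp.single 0 t : Exp n) = 0 := by
  simp [under]

theorem monomial_under_mem_iff {J : Ideal (Poly n K)} {γ : Exp n} :
    monomial (under γ) (1 : K) ∈ underIdeal J ↔ monomial γ (1 : K) ∈ underIdeal J := by
  refine ⟨fun h => monomial_mem_of_le h (under_le γ), fun h => ?_⟩
  obtain ⟨t, ht⟩ := under_mem_iff.1 h
  refine under_mem_iff.2 ⟨γ 0 + t, ?_⟩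
  rwa [Finsupp.single_add, ← add_assoc, under_add_single]

theorem IncreasingMove.add_right {α β : Exp n} (h : IncreasingMove α β) (τ : Exp n) :
    IncreasingMove (α + τ) (β + τ) := by
  obtain ⟨i, j, hij, he⟩ := h
  refine ⟨i, j, hij, ?_⟩
  rw [add_right_comm, he, add_right_comm]

theorem IsStronglyStable.underIdeal {J : Ideal (Poly n K)} (hJ : IsStronglyStable J) :
    IsStronglyStable (underIdeal J) := by
  intro α β hα hαβ
  obtain ⟨t, ht⟩ := under_mem_iff.1 hα
  refine under_mem_iff.2 ⟨t, hJ _ _ ht ?_⟩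
  exact Relation.TransGen.lift (fun γ => γ + Finsupp.single 0 t) (fun _ _ h => h.add_right _) _ _ hαβ

/-- The factors `x_0` are traded one at a time for `x_j`. Thus saturating a strongly stable ideal by
`x_0` already saturates it by every variable. -/
theorem IsStronglyStable.mem_of_add_single_zero {J : Ideal (Poly n K)} (hJ : IsStronglyStable J)
    (j : Fin (n + 1)) (t : ℕ) (γ : Exp n)
    (h : monomial (γ + Finsupp.single 0 t) (1 : K) ∈ J) :
    monomial (γ + Finsupp.single j t) (1 : K) ∈ J := by
  induction t generalizing γ with
  | zero => simpa using h
  | succ t ih =>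
    by_cases hj : j = 0
    · rwa [hj]
    have h1 : monomial (γ + Finsupp.single j 1 + Finsupp.single 0 t) (1 : K) ∈ J := by
      refine hJ _ _ h (Relation.TransGen.single ⟨0, j, Fin.pos_iff_ne_zero.2 hj, ?_⟩)
      rw [Finsupp.single_add]
      abel
    have := ih _ h1
    rw [add_comm t, Finsupp.single_add, ← add_assoc]
    exact this

theorem mem_iff_of_isTruncation {m : ℕ} {J : Ideal (Poly n K)} (hJ : IsStronglyStable J)
    (htr : IsTruncation m J) (γ : Exp n) :
    monomial γ (1 : K) ∈ J ↔ monomial γ (1 : K) ∈ underIdeal J ∧ m ≤ γ.degree := by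
  have hX : ∀ (j : Fin (n + 1)) (r : ℕ), X j ^ r * monomial γ (1 : K) =
      monomial (γ + Finsupp.single j r) 1 := by
    intro j r
    rw [X_pow_eq_monomial, monomial_mul, one_mul, add_comm γ]
  rw [htr (monomial γ 1), forall_mem_support_monomial]
  simp only [saturation, Set.mem_ofPred_eq, hX, under_mem_iff]
  refine and_congr_left fun _ => ⟨fun h => h 0, fun ⟨t, ht⟩ j => ⟨t, ?_⟩⟩
  exact hJ.mem_of_add_single_zero j t γ ht

theorem exists_superminimal {J : Ideal (Poly n K)} {β : Exp n}
    (h : β ∈ monomialBasis (underIdeal J)) : ∃ α ∈ superminimals J, under α = β := by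
  obtain ⟨t, ht⟩ := under_mem_iff.1 h.1
  obtain ⟨α, hα, hle⟩ := exists_monomialBasis_le ht
  have hαβ : under α ≤ β := fun i => by
    have := hle i
    rw [under_apply]
    split_ifs with h
    · exact Nat.zero_le _
    · simpa [Finsupp.single_apply, Ne.symm h] using this
  have := h.2 _ (monomial_under_mem_iff.2 (mem_underIdeal_of_mem hα.1)) hαβ
  exact ⟨α, ⟨hα, this ▸ h⟩, this⟩

/-- Two generators with the same image differ by a power of `x_0`, so one divides the other. -/
theorem under_injOn_monomialBasis (J : Ideal (Poly n K)) :
    Set.InjOn under (monomialBasis J) := by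
  have key : ∀ α ∈ monomialBasis J, ∀ β ∈ monomialBasis J, under α = under β → α 0 ≤ β 0 →
      α = β := by
    intro α hα β hβ h h0
    refine hβ.2 _ hα.1 ?_
    rw [← under_add_single α, ← under_add_single β, h]
    gcongr
  intro α hα β hβ h
  rcases le_total (α 0) (β 0) with h0 | h0
  · exact key α hα β hβ h h0
  · exact (key β hβ α hα h.symm h0).symm

theorem superminimals_subset (J : Ideal (Poly n K)) : superminimals J ⊆ monomialBasis J :=
  fun _ h => h.1

theorem mem_sousEscalierDeg {J : Ideal (Poly n K)} {d : ℕ} {γ : Exp n} :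
    γ ∈ sousEscalierDeg J d ↔ γ.degree = d ∧ γ ∈ sousEscalier J := by
  simp [sousEscalierDeg, Finset.mem_finsuppAntidiag, Finsupp.degree_eq_sum]

end Combinatorics

/-! ### Abstract triangular reduction: termination and unique normal forms. -/

section Ranked

variable {n : ℕ} {A : Type*} [CommRing A] {W : Type*} [LinearOrder W]
  {r : Exp n → W} {P : Set (Marked n A)}

/-- The polynomials in `P` are determined by their heads, which have coefficient `1` and greater
rank than the other monomials. -/
structure IsRanked (r : Exp n → W) (P : Set (Marked n A)) : Prop where
  injOn : Set.InjOn Marked.head P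
  coeff_head : ∀ q ∈ P, q.poly.coeff q.head = 1
  rank_lt : ∀ q ∈ P, ∀ δ, δ ≠ q.head → q.poly.coeff δ ≠ 0 → r δ < r q.head

/-- Elimination of the monomial `q.head` by means of some `q ∈ P`. -/
def ReductionStep (P : Set (Marked n A)) (h h₁ : Poly n A) : Prop :=
  ∃ q ∈ P, q.head ∈ h.support ∧ h₁ = h - C (h.coeff q.head) * q.poly

/-- In a nontrivial combination choose an element whose head has maximal rank. No other element of
the combination contains this head, because its non-head monomials have smaller rank than its own
head; so the head survives. -/
theorem IsRanked.eq_zero_of_mem_span (hP : IsRanked r P) {h : Poly n A}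
    (hh : h ∈ Submodule.span A (Marked.poly '' P)) (hs : ∀ q ∈ P, h.coeff q.head = 0) : h = 0 := by
  rw [Finsupp.mem_span_image_iff_linearCombination] at hh
  obtain ⟨l, hl, rfl⟩ := hh
  rw [Finsupp.mem_supported] at hl
  by_cases hl0 : l = 0
  · simp [hl0]
  exfalso
  obtain ⟨q, hq, hmax⟩ := l.support.exists_max_image (fun q => r q.head)
    (Finsupp.support_nonempty_iff.2 hl0)
  have hc := hs q (hl hq)
  rw [Finsupp.linearCombination_apply, Finsupp.sum, coeff_sum,
    Finset.sum_eq_single_of_mem q hq] at hc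
  · rw [coeff_smul, hP.coeff_head q (hl hq), smul_eq_mul, mul_one] at hc
    exact (Finsupp.mem_support_iff.1 hq) hc
  · intro q' hq' hne
    rw [coeff_smul, smul_eq_mul]
    by_contra hcon
    have h1 : q'.poly.coeff q.head ≠ 0 := right_ne_zero_of_mul hcon
    have h2 : q.head ≠ q'.head := fun he => hne (hP.injOn (hl hq') (hl hq) he.symm)
    exact absurd (hmax q' hq') (not_le.2 (hP.rank_lt q' (hl hq') _ h2 h1))

/-- The multiset of the ranks of the monomials of `h`. -/
def rankMultiset (r : Exp n → W) (h : Poly n A) : Multiset W := h.support.val.map r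

/-- The head disappears, and every monomial that appears has rank below that of the head. This is a
descent in the Dershowitz–Manna order, the monomials common to both supports being the unchanged
part. -/
theorem IsRanked.rankMultiset_lt (hP : IsRanked r P) {h h₁ : Poly n A}
    (hs : ReductionStep P h h₁) :
    Multiset.IsDershowitzMannaLT (rankMultiset r h₁) (rankMultiset r h) := by
  classical
  obtain ⟨q, hq, hh, rfl⟩ := hs
  set h₁ := h - C (h.coeff q.head) * q.poly with h₁_def
  have hq1 : q.head ∉ h₁.support := by
    simp [h₁_def, coeff_C_mul, hP.coeff_head q hq]
  have hsplit : ∀ s t : Finset (Exp n),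
      s.val.map r = (s ∩ t).val.map r + (s \ t).val.map r := by
    intro s t
    rw [← Multiset.map_add, Finset.inter_val, Finset.sdiff_val, add_comm,
      Multiset.sub_add_inter]
  refine ⟨(h.support ∩ h₁.support).val.map r, (h₁.support \ h.support).val.map r,
    (h.support \ h₁.support).val.map r, ?_, ?_, ?_, ?_⟩
  · intro h0
    have : q.head ∈ h.support \ h₁.support := Finset.mem_sdiff.2 ⟨hh, hq1⟩
    have h0 := Finset.val_eq_zero.1 (Multiset.map_eq_zero.1 h0)
    simp [h0] at this
  · rw [Finset.inter_comm]
    exact hsplit _ _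
  · exact hsplit _ _
  · intro y hy
    obtain ⟨δ, hδ, rfl⟩ := Multiset.mem_map.1 hy
    refine ⟨r q.head, Multiset.mem_map.2 ⟨q.head, Finset.mem_sdiff.2 ⟨hh, hq1⟩, rfl⟩, ?_⟩
    obtain ⟨hδ1, hδ2⟩ := Finset.mem_sdiff.1 hδ
    have hδ0 : h.coeff δ = 0 := by simpa using hδ2
    rw [mem_support_iff, h₁_def, coeff_sub, hδ0, coeff_C_mul, zero_sub, neg_ne_zero] at hδ1
    exact hP.rank_lt q hq δ (fun he => hδ2 (he ▸ hh)) (right_ne_zero_of_mul hδ1)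

theorem IsRanked.wellFounded [WellFoundedLT W] (hP : IsRanked r P) :
    WellFounded (fun h₁ h : Poly n A => ReductionStep P h h₁) :=
  Subrelation.wf (fun hs => hP.rankMultiset_lt hs)
    (InvImage.wf (rankMultiset r) Multiset.wellFounded_isDershowitzMannaLT)

theorem sub_mem_span_of_reduces {h R : Poly n A}
    (hR : Relation.ReflTransGen (ReductionStep P) h R) :
    h - R ∈ Submodule.span A (Marked.poly '' P) := by
  induction hR with
  | refl => simp
  | tail _ hs ih =>
    obtain ⟨q, hq, -, rfl⟩ := hs
    rw [← sub_add, C_mul']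
    exact add_mem ih (Submodule.smul_mem _ _ (Submodule.subset_span ⟨q, hq, rfl⟩))

/-- The rank bound on the reducers is what the Buchberger criterion needs: an S-polynomial of small
rank is rewritten by small multiples only. -/
theorem IsRanked.sub_mem_span_of_reduces (hP : IsRanked r P) {w : W} {h R : Poly n A}
    (hR : Relation.ReflTransGen (ReductionStep P) h R) (hw : ∀ γ ∈ h.support, r γ < w) :
    h - R ∈ Submodule.span A (Marked.poly '' {q ∈ P | r q.head < w}) ∧
      ∀ γ ∈ R.support, r γ < w := by
  induction hR with
  | refl => exact ⟨by simp, hw⟩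
  | @tail b _ _ hs ih =>
    obtain ⟨q, hq, hh, rfl⟩ := hs
    have hqw := ih.2 _ hh
    constructor
    · rw [← sub_add, C_mul']
      exact add_mem ih.1 (Submodule.smul_mem _ _ (Submodule.subset_span ⟨q, ⟨hq, hqw⟩, rfl⟩))
    · intro γ hγ
      by_contra hcon
      have h0 : b.coeff γ = 0 := notMem_support_iff.1 (fun hmem => hcon (ih.2 γ hmem))
      rw [mem_support_iff, coeff_sub, h0, coeff_C_mul, zero_sub, neg_ne_zero] at hγ
      by_cases he : γ = q.head
      · exact hcon (he ▸ hqw)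
      · exact hcon ((hP.rank_lt q hq γ he (right_ne_zero_of_mul hγ)).trans hqw)

theorem IsRanked.reduces_unique (hP : IsRanked r P) {h R R' : Poly n A}
    (hR : Relation.ReflTransGen (ReductionStep P) h R)
    (hR' : Relation.ReflTransGen (ReductionStep P) h R')
    (h0 : ∀ q ∈ P, R.coeff q.head = 0) (h0' : ∀ q ∈ P, R'.coeff q.head = 0) : R = R' := by
  refine sub_eq_zero.1 (hP.eq_zero_of_mem_span ?_ fun q hq => ?_)
  · have := sub_mem (MarkedScheme.sub_mem_span_of_reduces hR')
      (MarkedScheme.sub_mem_span_of_reduces hR)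
    simpa using this
  · rw [coeff_sub, h0 q hq, h0' q hq, sub_zero]

theorem coeff_eq_zero_of_irreducible {h : Poly n A} (hirr : ∀ h₁, ¬ ReductionStep P h h₁)
    {q : Marked n A} (hq : q ∈ P) : h.coeff q.head = 0 := by
  by_contra hne
  exact hirr _ ⟨q, hq, mem_support_iff.2 hne, rfl⟩

end Ranked

/-! ### Common theory of both reductions, with a Buchberger criterion. -/

section Systems

variable {n : ℕ} {K : Type*} [Field K] {A : Type*} [CommRing A]

theorem exists_of_coeff_monomial_mul_ne_zero {ε δ : Exp n} {a : A} {h : Poly n A}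
    (hne : (monomial ε a * h).coeff δ ≠ 0) : ∃ δ', δ = ε + δ' ∧ h.coeff δ' ≠ 0 := by
  rw [coeff_monomial_mul'] at hne
  split_ifs at hne with hle
  · exact ⟨δ - ε, (add_tsub_cancel_of_le hle).symm, right_ne_zero_of_mul hne⟩
  · exact absurd rfl hne

/-- `u` restricts exponents to a set of variables. -/
structure IsRestriction (u : Exp n → Exp n) : Prop where
  add : ∀ α β, u (α + β) = u α + u β
  tsub : ∀ α β, u (α - β) = u α - u β
  sup : ∀ α β, u (α ⊔ β) = u α ⊔ u β
  le : ∀ α, u α ≤ α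
  idem : ∀ α, u (u α) = u α
  single : ∀ α, ∀ j ∈ (u α).support, u (Finsupp.single j 1) = Finsupp.single j 1

theorem IsRestriction.zero {u : Exp n → Exp n} (hu : IsRestriction u) : u 0 = 0 := by
  simpa using hu.le 0

/-- The data for a reduction procedure: the polynomials `f α` with heads `α ∈ B`; the heads
correspond under `u` to the minimal generators of `I`, and the tails avoid `I`. -/
structure IsSystem (u : Exp n → Exp n) (I : Ideal (Poly n K)) (B : Set (Exp n))
    (f : Exp n → Poly n A) : Prop where
  restr : IsRestriction u
  basis : ∀ α ∈ B, u α ∈ monomialBasis I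
  injOn : Set.InjOn u B
  surj : ∀ β ∈ monomialBasis I, ∃ α ∈ B, u α = β
  coeff_head : ∀ α ∈ B, (f α).coeff α = 1
  tail : ∀ α ∈ B, ∀ δ, δ ≠ α → (f α).coeff δ ≠ 0 → monomial (u δ) (1 : K) ∉ I

/-- The multiples `x^ε f α` used for reduction. -/
def multiples (u : Exp n → Exp n) (I : Ideal (Poly n K)) (B : Set (Exp n))
    (f : Exp n → Poly n A) : Set (Marked n A) :=
  {q | ∃ α ∈ B, ∃ ε, IsStar I (u α + u ε) (u α) (u ε) ∧ q = ⟨α + ε, monomial ε 1 * f α⟩}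

variable {u : Exp n → Exp n} {I : Ideal (Poly n K)} {B : Set (Exp n)} {f : Exp n → Poly n A}

/-- The head `x^α x^ε` has rank `u ε`, and uniqueness of star decompositions recovers `α` and `ε`
from it. The other monomials have smaller rank by `rank_add_lt`, since tails avoid `I`. -/
theorem IsSystem.isRanked (hS : IsSystem u I B f) :
    IsRanked (fun γ => rank I (u γ)) (multiples u I B f) where
  injOn := by
    rintro _ ⟨α, hα, ε, hst, rfl⟩ _ ⟨α', hα', ε', hst', rfl⟩ he
    change α + ε = α' + ε' at he
    have hue : u α + u ε = u α' + u ε' := by rw [← hS.restr.add, he, hS.restr.add]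
    have := hS.injOn hα hα' (hst.unique (hue ▸ hst')).1
    subst this
    have := add_left_cancel he
    subst this
    rfl
  coeff_head := by
    rintro _ ⟨α, hα, ε, hst, rfl⟩
    change coeff (α + ε) (monomial ε 1 * f α) = 1
    rw [add_comm α ε, coeff_monomial_mul, one_mul, hS.coeff_head α hα]
  rank_lt := by
    rintro _ ⟨α, hα, ε, hst, rfl⟩ δ hne hδ
    obtain ⟨δ', rfl, hδ'⟩ := exists_of_coeff_monomial_mul_ne_zero hδ
    change rank I (u (ε + δ')) < rank I (u (α + ε))
    rw [hS.restr.add, hS.restr.add, hst.rank_eq]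
    refine rank_add_lt (hS.tail α hα δ' (fun h => hne ?_) hδ')
    rw [h, add_comm]

theorem multiples_mul (hu : IsRestriction u) {τ : Exp n} (hτ : u τ = 0) {q : Marked n A}
    (hq : q ∈ multiples u I B f) :
    (⟨τ + q.head, monomial τ 1 * q.poly⟩ : Marked n A) ∈ multiples u I B f := by
  obtain ⟨α, hα, ε, hst, rfl⟩ := hq
  refine ⟨α, hα, τ + ε, ?_, ?_⟩
  · rwa [hu.add, hτ, zero_add]
  · rw [← mul_assoc, monomial_mul, one_mul, add_left_comm]

theorem ReductionStep.monomial_mul (hu : IsRestriction u) {τ : Exp n} (hτ : u τ = 0)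
    {h h₁ : Poly n A} (hs : ReductionStep (multiples u I B f) h h₁) :
    ReductionStep (multiples u I B f) (monomial τ 1 * h) (monomial τ 1 * h₁) := by
  obtain ⟨q, hq, hh, rfl⟩ := hs
  refine ⟨_, multiples_mul hu hτ hq, ?_, ?_⟩
  · rw [mem_support_iff] at hh ⊢
    rwa [coeff_monomial_mul, one_mul]
  · rw [coeff_monomial_mul, one_mul]
    ring

theorem reduces_monomial_mul (hu : IsRestriction u) {τ : Exp n} (hτ : u τ = 0)
    {h h₁ : Poly n A} (hs : Relation.ReflTransGen (ReductionStep (multiples u I B f)) h h₁) :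
    Relation.ReflTransGen (ReductionStep (multiples u I B f))
      (monomial τ 1 * h) (monomial τ 1 * h₁) :=
  Relation.ReflTransGen.lift (fun g => monomial τ 1 * g)
    (fun _ _ h => ReductionStep.monomial_mul hu hτ h) _ _ hs

theorem rankMultiset_monomial_mul (hu : IsRestriction u) {τ : Exp n} (hτ : u τ = 0)
    (h : Poly n A) :
    rankMultiset (fun γ => rank I (u γ)) (monomial τ 1 * h) =
      rankMultiset (fun γ => rank I (u γ)) h := by
  have : (monomial τ 1 * h).support = h.support.map (addLeftEmbedding τ) := by
    ext δ
    rw [mem_support_iff, Finset.mem_map]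
    constructor
    · intro hne
      obtain ⟨δ', rfl, hδ'⟩ := exists_of_coeff_monomial_mul_ne_zero hne
      exact ⟨δ', mem_support_iff.2 hδ', rfl⟩
    · rintro ⟨δ', hδ', rfl⟩
      rw [addLeftEmbedding_apply, coeff_monomial_mul, one_mul]
      exact mem_support_iff.1 hδ'
  rw [rankMultiset, this, Finset.map_val, Multiset.map_map, rankMultiset]
  refine Multiset.map_congr rfl fun γ _ => ?_
  simp [hu.add, hτ]

/-- A monomial `x^γ` with `x^{u γ} ∈ I` becomes reducible after multiplication by `x^τ`. -/
theorem IsSystem.exists_multiple (hS : IsSystem u I B f) (hI : HasStars I) {γ : Exp n}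
    (hγ : monomial (u γ) (1 : K) ∈ I) :
    ∃ τ, u τ = 0 ∧ ∃ q ∈ multiples u I B f, q.head = τ + γ := by
  obtain ⟨β, η, hst⟩ := hI _ hγ
  obtain ⟨α, hα, rfl⟩ := hS.surj β hst.2.1
  -- For `u = under`, `x^(α - u α)` is the power of `x_0` in the head `x^α`, which `x^γ` may lack;
  -- for `u = id` it is `1`.
  have hτ : u (α - u α) = 0 := by rw [hS.restr.tsub, hS.restr.idem, tsub_self]
  have hle : α ≤ (α - u α) + γ := by
    calc α = (α - u α) + u α := (tsub_add_cancel_of_le (hS.restr.le α)).symm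
      _ ≤ (α - u α) + u γ := by rw [hst.1]; gcongr; exact le_self_add
      _ ≤ _ := by gcongr; exact hS.restr.le γ
  have heq : α + ((α - u α) + γ - α) = (α - u α) + γ := add_tsub_cancel_of_le hle
  have hu1 : u α + u ((α - u α) + γ - α) = u γ := by
    rw [← hS.restr.add, heq, hS.restr.add, hτ, zero_add]
  have hu2 : u ((α - u α) + γ - α) = η := add_left_cancel (hu1.trans hst.1)
  refine ⟨α - u α, hτ, _, ⟨α, hα, (α - u α) + γ - α, ?_, rfl⟩, heq⟩
  rwa [hu1, hu2]

/-- Each reducible monomial may require a further factor `x^τ`. These factors leave the multiset of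
ranks unchanged, so the descent of the reduction steps still terminates. -/
theorem IsSystem.exists_reduces (hS : IsSystem u I B f) (hI : HasStars I) (h : Poly n A) :
    ∃ τ, u τ = 0 ∧ ∃ R, Relation.ReflTransGen (ReductionStep (multiples u I B f))
      (monomial τ 1 * h) R ∧ ∀ γ ∈ R.support, monomial (u γ) (1 : K) ∉ I := by
  refine (InvImage.wf (rankMultiset fun γ => rank I (u γ))
    Multiset.wellFounded_isDershowitzMannaLT).induction (C := fun h : Poly n A =>
      ∃ τ, u τ = 0 ∧ ∃ R, Relation.ReflTransGen (ReductionStep (multiples u I B f))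
        (monomial τ 1 * h) R ∧ ∀ γ ∈ R.support, monomial (u γ) (1 : K) ∉ I) h fun h ih => ?_
  by_cases hred : ∀ γ ∈ h.support, monomial (u γ) (1 : K) ∉ I
  · exact ⟨0, hS.restr.zero, h, by rw [← C_apply, C_1, one_mul], hred⟩
  push Not at hred
  obtain ⟨γ, hγ, hγI⟩ := hred
  obtain ⟨τ, hτ, q, hq, hqh⟩ := hS.exists_multiple hI hγI
  have hstep : ReductionStep (multiples u I B f) (monomial τ 1 * h)
      (monomial τ 1 * h - C ((monomial τ 1 * h).coeff q.head) * q.poly) := by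
    refine ⟨q, hq, ?_, rfl⟩
    rw [mem_support_iff, hqh, coeff_monomial_mul, one_mul]
    exact mem_support_iff.1 hγ
  have hlt := hS.isRanked.rankMultiset_lt hstep
  rw [rankMultiset_monomial_mul hS.restr hτ] at hlt
  obtain ⟨τ', hτ', R, hR, hRI⟩ := ih _ hlt
  refine ⟨τ' + τ, by rw [hS.restr.add, hτ, hτ', add_zero], R, ?_, hRI⟩
  have := reduces_monomial_mul hS.restr hτ' (Relation.ReflTransGen.single hstep)
  rw [← mul_assoc, monomial_mul, one_mul] at this
  exact this.trans hR

theorem monomial_mul_mem {s : Set (Poly n A)} {N : Submodule A (Poly n A)} {h : Poly n A}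
    (ε : Exp n) (hh : h ∈ Submodule.span A s) (hs : ∀ g ∈ s, monomial ε 1 * g ∈ N) :
    monomial ε 1 * h ∈ N := by
  have : Submodule.span A s ≤ N.comap (LinearMap.mulLeft A (monomial ε (1 : A))) :=
    Submodule.span_le.2 hs
  exact this hh

theorem monomial_mul_mem_span_multiples (hu : IsRestriction u) {τ : Exp n} (hτ : u τ = 0)
    {h : Poly n A} (hh : h ∈ Submodule.span A (Marked.poly '' multiples u I B f)) :
    monomial τ 1 * h ∈ Submodule.span A (Marked.poly '' multiples u I B f) := by
  refine monomial_mul_mem τ hh ?_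
  rintro _ ⟨q, hq, rfl⟩
  exact Submodule.subset_span ⟨_, multiples_mul hu hτ hq, rfl⟩

variable (I B f) in
/-- The polynomials `g` such that some `x^τ g` with `u τ = 0` is a combination of the
multiples used for reduction. -/
def satSpan (hu : IsRestriction u) : Submodule A (Poly n A) where
  carrier := {g | ∃ τ, u τ = 0 ∧
    monomial τ 1 * g ∈ Submodule.span A (Marked.poly '' multiples u I B f)}
  zero_mem' := ⟨0, hu.zero, by simp⟩
  add_mem' := by
    rintro g g' ⟨τ, hτ, hg⟩ ⟨τ', hτ', hg'⟩
    refine ⟨τ + τ', by rw [hu.add, hτ, hτ', add_zero], ?_⟩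
    have h1 := monomial_mul_mem_span_multiples hu hτ' hg
    have h2 := monomial_mul_mem_span_multiples hu hτ hg'
    rw [← mul_assoc, monomial_mul, one_mul] at h1 h2
    rw [mul_add]
    exact add_mem (by rwa [add_comm τ τ']) h2
  smul_mem' := by
    rintro a g ⟨τ, hτ, hg⟩
    refine ⟨τ, hτ, ?_⟩
    rw [mul_smul_comm]
    exact Submodule.smul_mem _ _ hg

theorem mem_satSpan_of_monomial_mul {hu : IsRestriction u} {g : Poly n A} {τ : Exp n}
    (hτ : u τ = 0) (hg : monomial τ 1 * g ∈ satSpan I B f hu) : g ∈ satSpan I B f hu := by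
  obtain ⟨τ', hτ', h⟩ := hg
  refine ⟨τ' + τ, by rw [hu.add, hτ, hτ', add_zero], ?_⟩
  rwa [← mul_assoc, monomial_mul, one_mul] at h

theorem span_le_satSpan (hu : IsRestriction u) :
    Submodule.span A (Marked.poly '' multiples u I B f) ≤ satSpan I B f hu :=
  fun g hg => ⟨0, hu.zero, by rwa [← C_apply, C_1, one_mul]⟩

/-- Multiplication by `x^τ` does not affect membership of `u`-images in `I`, so `x^τ h` contains no
head and vanishes by triangularity. -/
theorem IsSystem.eq_zero_of_mem_satSpan (hS : IsSystem u I B f) {h : Poly n A}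
    (hh : h ∈ satSpan I B f hS.restr) (hred : ∀ γ ∈ h.support, monomial (u γ) (1 : K) ∉ I) :
    h = 0 := by
  obtain ⟨τ, hτ, hspan⟩ := hh
  have h0 : monomial τ 1 * h = 0 := by
    refine hS.isRanked.eq_zero_of_mem_span hspan ?_
    rintro _ ⟨α, hα, ε, hst, rfl⟩
    by_contra hne
    obtain ⟨δ, hδ, hδne⟩ := exists_of_coeff_monomial_mul_ne_zero hne
    refine hred δ (mem_support_iff.2 hδne) ?_
    have hmem := hst.mem
    rw [← hS.restr.add] at hmem
    change α + ε = τ + δ at hδ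
    rwa [hδ, hS.restr.add, hτ, zero_add] at hmem
  ext δ
  have := congrArg (coeff (τ + δ)) h0
  rwa [coeff_monomial_mul, one_mul, coeff_zero] at this

/-- The multiples of the `f β` by monomials with exponent smaller than that of `x_j`. -/
def smallMultiples (u : Exp n → Exp n) (B : Set (Exp n)) (f : Exp n → Poly n A)
    (j : Fin (n + 1)) : Set (Poly n A) :=
  {g | ∃ β ∈ B, ∃ ε, toColex (u ε) < toColex (Finsupp.single j 1) ∧ g = monomial ε 1 * f β}

/-- `(α, α')` is a pair of heads with `x_j x^{u α} = x^{u α'} *_I x^η` and `x_j > min(x^{u α})`. -/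
structure IsCriticalPair (u : Exp n → Exp n) (I : Ideal (Poly n K)) (B : Set (Exp n))
    (j : Fin (n + 1)) (α α' η : Exp n) : Prop where
  left : α ∈ B
  right : α' ∈ B
  single : u (Finsupp.single j 1) = Finsupp.single j 1
  exists_lt : ∃ i ∈ (u α).support, i < j
  star : IsStar I (Finsupp.single j 1 + u α) (u α') η

theorem IsSystem.tails_of_criticalPair (hS : IsSystem u I B f) {j : Fin (n + 1)} {α α' η : Exp n}
    (hp : IsCriticalPair u I B j α α' η) :
    u ((α ⊔ α') - α) = Finsupp.single j 1 ∧ u ((α ⊔ α') - α') = η := by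
  obtain ⟨hα, hα', hj, ⟨i, hi, hij⟩, hst⟩ := hp
  have hsup : u α ⊔ u α' = Finsupp.single j 1 + u α := by
    have hc : ∀ l, Finsupp.single j 1 l + u α l = u α' l + η l := fun l => by
      have := DFunLike.congr_fun hst.1 l
      simpa using this
    -- Otherwise `x^{u α'}` divides `x^{u α}`, hence equals it, and the tail would be `x_j`,
    -- contrary to `i < j`. It follows that the lcm is `x_j x^{u α}`.
    have hj' : u α j < u α' j := by
      by_contra hcon
      have hle : u α' ≤ u α := fun l => by
        have := hc l
        by_cases hl : l = j
        · subst hl; omega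
        · rw [Finsupp.single_eq_of_ne hl] at this
          omega
      have heq := (hS.basis α hα).2 _ (hS.basis α' hα').1 hle
      have hη : η = Finsupp.single j 1 := by
        have := hst.1
        rw [heq, add_comm] at this
        exact (add_left_cancel this).symm
      exact absurd (hst.2.2 i (heq ▸ hi) j (by simp [hη])) (not_le.2 hij)
    ext l
    have := hc l
    rw [Finsupp.sup_apply, Finsupp.add_apply]
    by_cases hl : l = j
    · subst hl
      rw [Finsupp.single_eq_same] at this ⊢
      omega
    · rw [Finsupp.single_eq_of_ne hl] at this ⊢
      omega
  rw [hS.restr.tsub, hS.restr.tsub, hS.restr.sup, hsup]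
  refine ⟨add_tsub_cancel_right _ _, ?_⟩
  rw [hst.1, add_tsub_cancel_left]

/-- The common head cancels. What remains comes from tails multiplied by monomials with `u`-image
`x_j` or `x^η`, and `η` is colex-smaller than `x_j`. -/
theorem IsSystem.rank_lt_of_criticalPair (hS : IsSystem u I B f) {j : Fin (n + 1)}
    {α α' η : Exp n} (hp : IsCriticalPair u I B j α α' η) :
    ∀ γ ∈ (sPoly ⟨α, f α⟩ ⟨α', f α'⟩).support,
      rank I (u γ) < ((toColex (Finsupp.single j 1) : Colex (Exp n)) : WithBot _) := by
  obtain ⟨h1, h2⟩ := hS.tails_of_criticalPair hp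
  have hη : toColex η < toColex (Finsupp.single j 1) := by
    obtain ⟨i, hi, hij⟩ := hp.exists_lt
    exact hp.star.tail_lt_single (hS.basis α hp.left) hi hij
  have key : ∀ β ∈ B, ∀ ε γ, γ ≠ ε + β → (monomial ε 1 * f β).coeff γ ≠ 0 →
      rank I (u γ) < ((toColex (u ε) : Colex (Exp n)) : WithBot _) := by
    intro β hβ ε γ hne hγ
    obtain ⟨δ, rfl, hδ⟩ := exists_of_coeff_monomial_mul_ne_zero hγ
    rw [hS.restr.add]
    exact rank_add_lt (hS.tail β hβ δ (fun h => hne (by rw [h])) hδ)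
  have e1 : α ⊔ α' - α + α = α ⊔ α' := tsub_add_cancel_of_le le_sup_left
  have e2 : α ⊔ α' - α' + α' = α ⊔ α' := tsub_add_cancel_of_le le_sup_right
  intro γ hγ
  rw [mem_support_iff, sPoly, coeff_sub] at hγ
  by_cases hγe : γ = α ⊔ α'
  · subst hγe
    refine absurd ?_ hγ
    have hc1 := coeff_monomial_mul α (α ⊔ α' - α) 1 (f α)
    have hc2 := coeff_monomial_mul α' (α ⊔ α' - α') 1 (f α')
    rw [e1, hS.coeff_head α hp.left] at hc1
    rw [e2, hS.coeff_head α' hp.right] at hc2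
    exact sub_eq_zero.2 (hc1.trans hc2.symm)
  · by_cases h0 : (monomial (α ⊔ α' - α) 1 * f α).coeff γ = 0
    · have h0' : (monomial (α ⊔ α' - α') 1 * f α').coeff γ ≠ 0 := by
        intro h0'
        exact hγ (by simp only [h0, h0', sub_zero])
      refine (key α' hp.right _ _ (by rwa [e2]) h0').trans ?_
      rw [h2, WithBot.coe_lt_coe]
      exact hη
    · have := key α hp.left _ _ (by rwa [e1]) h0
      rwa [h1] at this

theorem sPoly_map {A' : Type*} [CommRing A'] (φ : A →+* A') (α α' : Exp n) (p p' : Poly n A) :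
    sPoly ⟨α, map φ p⟩ ⟨α', map φ p'⟩ = map φ (sPoly ⟨α, p⟩ ⟨α', p'⟩) := by
  simp [sPoly]

/-- The reduction takes place over `A` and only its resulting linear combination is carried to `A'`:
reduction steps need not survive `φ`, since coefficients may vanish. -/
theorem IsSystem.mem_span_smallMultiples (hS : IsSystem u I B f) {j : Fin (n + 1)}
    {α α' η : Exp n} (hp : IsCriticalPair u I B j α α' η) {A' : Type*} [CommRing A']
    (φ : A →+* A') {f' : Exp n → Poly n A'} (hf : ∀ β ∈ B, f' β = map φ (f β)) {τ : Exp n}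
    (hτ : u τ = 0) {R : Poly n A} (hR : Relation.ReflTransGen
      (ReductionStep (multiples u I B f)) (monomial τ 1 * sPoly ⟨α, f α⟩ ⟨α', f α'⟩) R)
    (hφ : map φ R = 0) :
    monomial τ 1 * sPoly ⟨α, f' α⟩ ⟨α', f' α'⟩ ∈ Submodule.span A' (smallMultiples u B f' j) := by
  have hw : ∀ γ ∈ (monomial τ 1 * sPoly ⟨α, f α⟩ ⟨α', f α'⟩).support,
      rank I (u γ) < ((toColex (Finsupp.single j 1) : Colex (Exp n)) : WithBot _) := by
    intro γ hγ
    obtain ⟨δ, rfl, hδ⟩ := exists_of_coeff_monomial_mul_ne_zero (mem_support_iff.1 hγ)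
    rw [hS.restr.add, hτ, zero_add]
    exact hS.rank_lt_of_criticalPair hp δ (mem_support_iff.2 hδ)
  have hmem := (hS.isRanked.sub_mem_span_of_reduces hR hw).1
  have heq : monomial τ 1 * sPoly ⟨α, f' α⟩ ⟨α', f' α'⟩ =
      map φ (monomial τ 1 * sPoly ⟨α, f α⟩ ⟨α', f α'⟩ - R) := by
    rw [map_sub, hφ, sub_zero, map_mul, map_monomial, φ.map_one, hf α hp.left, hf α' hp.right,
      sPoly_map]
  rw [heq]
  generalize monomial τ 1 * sPoly ⟨α, f α⟩ ⟨α', f α'⟩ - R = g at hmem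
  induction hmem using Submodule.span_induction with
  | mem g hg =>
    obtain ⟨_, ⟨⟨β, hβ, ε, hst, rfl⟩, hlt⟩, rfl⟩ := hg
    refine Submodule.subset_span ⟨β, hβ, ε, ?_, ?_⟩
    · change rank I (u (β + ε)) < _ at hlt
      rwa [hS.restr.add, hst.rank_eq, WithBot.coe_lt_coe] at hlt
    · rw [map_mul, map_monomial, φ.map_one, hf β hβ]
  | zero => simp
  | add g g' _ _ h h' => rw [map_add]; exact add_mem h h'
  | smul a g _ h =>
    rw [← C_mul', map_mul, map_C, C_mul']
    exact Submodule.smul_mem _ _ h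

/-- If the S-polynomials of the critical pairs reduce to zero, all multiples of the `f α`
belong to `satSpan`. -/
theorem IsSystem.monomial_mul_mem_satSpan (hS : IsSystem u I B f) (hI : HasStars I)
    (hpair : ∀ j α α' η, IsCriticalPair u I B j α α' η → ∃ τ, u τ = 0 ∧
      monomial τ 1 * sPoly ⟨α, f α⟩ ⟨α', f α'⟩ ∈ Submodule.span A (smallMultiples u B f j))
    {α : Exp n} (hα : α ∈ B) (ε : Exp n) :
    monomial ε 1 * f α ∈ satSpan I B f hS.restr := by
  induction hk : (toColex (u ε) : Colex (Exp n)) using WellFoundedLT.induction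
    generalizing ε α with
  | ind k ih =>
    subst hk
    by_cases hst : ∀ i ∈ (u α).support, ∀ j ∈ (u ε).support, j ≤ i
    · exact span_le_satSpan _ (Submodule.subset_span
        ⟨_, ⟨α, hα, ε, ⟨rfl, hS.basis α hα, hst⟩, rfl⟩, rfl⟩)
    push Not at hst
    -- A failure of the star condition supplies a variable `x_j` of the multiplier with `i < j`. The
    -- S-polynomial of `α` and of the generator in the star decomposition of `x_j x^{u α}` rewrites
    -- `x_j f_α`, up to a factor invisible to `u`.
    obtain ⟨i, hi, j, hj, hij⟩ := hst
    have hsingle := hS.restr.single ε j hj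
    obtain ⟨β, η, hβ⟩ := hI (Finsupp.single j 1 + u α)
      (monomial_mem_of_le (hS.basis α hα).1 le_add_self)
    obtain ⟨α', hα', rfl⟩ := hS.surj β hβ.2.1
    have hp : IsCriticalPair u I B j α α' η := ⟨hα, hα', hsingle, ⟨i, hi, hij⟩, hβ⟩
    obtain ⟨h1, h2⟩ := hS.tails_of_criticalPair hp
    obtain ⟨τ, hτ, hmem⟩ := hpair j α α' η hp
    have hmem' : monomial (τ + (α ⊔ α' - α)) 1 * f α ∈
        Submodule.span A (smallMultiples u B f j) := by
      have hsmall : monomial (τ + (α ⊔ α' - α')) 1 * f α' ∈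
          Submodule.span A (smallMultiples u B f j) := by
        refine Submodule.subset_span ⟨α', hα', _, ?_, rfl⟩
        rw [hS.restr.add, hτ, zero_add, h2]
        exact hβ.tail_lt_single (hS.basis α hα) hi hij
      have := add_mem hmem hsmall
      rw [sPoly, mul_sub, ← mul_assoc, ← mul_assoc, monomial_mul, monomial_mul, one_mul,
        sub_add_cancel] at this
      exact this
    have hle : Finsupp.single j 1 ≤ ε := by
      rw [Finsupp.single_le_iff, Nat.one_le_iff_ne_zero]
      intro h0
      have := hS.restr.le ε j
      rw [h0] at this
      exact (Finsupp.mem_support_iff.1 hj) (Nat.le_zero.1 this)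
    have huε : u (ε - Finsupp.single j 1) + Finsupp.single j 1 = u ε := by
      conv_lhs => rw [← hsingle, ← hS.restr.add]
      rw [hsingle, tsub_add_cancel_of_le hle]
    -- Colex is compatible with addition: exponents smaller than that of `x_j` become smaller than
    -- `u ε` after multiplication by `x^ε / x_j`, so the induction applies.
    have hprod : monomial (ε - Finsupp.single j 1) 1 * (monomial (τ + (α ⊔ α' - α)) 1 * f α) ∈
        satSpan I B f hS.restr := by
      refine monomial_mul_mem _ hmem' ?_
      rintro _ ⟨β, hβ, ε', hlt, rfl⟩
      rw [← mul_assoc, monomial_mul, one_mul]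
      refine ih _ ?_ hβ _ rfl
      rw [← huε, hS.restr.add, toColex_add, toColex_add]
      gcongr
    have hle' : Finsupp.single j 1 ≤ α ⊔ α' - α := h1 ▸ hS.restr.le _
    -- The S-polynomial multiplier of `f α` is `x_j` times a monomial killed by `u`; that monomial
    -- and `x^τ` are absorbed by `satSpan`.
    refine mem_satSpan_of_monomial_mul
      (τ := τ + ((α ⊔ α' - α) - Finsupp.single j 1)) ?_ ?_
    · rw [hS.restr.add, hτ, hS.restr.tsub, h1, hsingle, tsub_self, zero_add]
    · convert hprod using 1
      rw [← mul_assoc, ← mul_assoc, monomial_mul, monomial_mul]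
      congr 3
      ext l
      have := hle l
      have := hle' l
      simp only [Finsupp.coe_add, Finsupp.coe_tsub, Pi.add_apply, Pi.sub_apply] at *
      omega

theorem IsSystem.mul_mem_satSpan (hS : IsSystem u I B f)
    (hmul : ∀ α ∈ B, ∀ ε, monomial ε 1 * f α ∈ satSpan I B f hS.restr)
    (p : Poly n A) {h : Poly n A} (hh : h ∈ satSpan I B f hS.restr) :
    p * h ∈ satSpan I B f hS.restr := by
  induction p using MvPolynomial.induction_on' with
  | monomial ε a =>
    have : monomial ε a = a • monomial ε 1 := by simp [smul_monomial]
    rw [this, smul_mul_assoc]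
    refine Submodule.smul_mem _ _ ?_
    obtain ⟨τ, hτ, hspan⟩ := hh
    refine mem_satSpan_of_monomial_mul hτ ?_
    rw [mul_left_comm]
    refine monomial_mul_mem ε hspan ?_
    rintro _ ⟨_, ⟨α, hα, ε', hst, rfl⟩, rfl⟩
    rw [← mul_assoc, monomial_mul, one_mul]
    exact hmul α hα _
  | add p q hp hq => rw [add_mul]; exact add_mem hp hq

theorem IsSystem.ideal_span_le_satSpan (hS : IsSystem u I B f)
    (hmul : ∀ α ∈ B, ∀ ε, monomial ε 1 * f α ∈ satSpan I B f hS.restr)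
    {s : Set (Poly n A)} (hs : ∀ g ∈ s, g ∈ satSpan I B f hS.restr) {h : Poly n A}
    (hh : h ∈ Ideal.span s) : h ∈ satSpan I B f hS.restr := by
  induction hh using Submodule.span_induction with
  | mem g hg => exact hs g hg
  | zero => exact zero_mem _
  | add g g' _ _ h h' => exact add_mem h h'
  | smul a g _ h => exact hS.mul_mem_satSpan hmul a h

end Systems

/-! ### Marked families over rings and the two concrete systems. -/

section Families

variable {n : ℕ} {K : Type*} [Field K] {A : Type*} [CommRing A] {J : Ideal (Poly n K)}
  {B : Set (Exp n)}

/-- Over a ring `A`: the `f α` with `α ∈ B` have head coefficient `1` and tails supported on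
`N(J)_{|α|}`. -/
def IsMarkedFamily (J : Ideal (Poly n K)) (B : Set (Exp n)) (f : Exp n → Poly n A) : Prop :=
  ∀ α ∈ B, (f α).coeff α = 1 ∧
    ∀ δ, δ ≠ α → (f α).coeff δ ≠ 0 → δ ∈ sousEscalierDeg J α.degree

/-- The marked polynomials `f α` with `α ∈ B`. -/
def markedSet (B : Set (Exp n)) (f : Exp n → Poly n A) : Set (Marked n A) :=
  (fun α => ⟨α, f α⟩) '' B

open Classical in
/-- The generic marked polynomials as a family indexed by all exponents. -/
def genericFamily (J : Ideal (Poly n K)) (B : Set (Exp n)) :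
    Exp n → Poly n (MvPolynomial (Param J B) K) :=
  fun α => if h : α ∈ B then (generic J B α h).poly else 0

theorem genericFamily_of_mem {α : Exp n} (h : α ∈ B) :
    genericFamily J B α = (generic J B α h).poly := dif_pos h

theorem genericSet_eq (J : Ideal (Poly n K)) (B : Set (Exp n)) :
    genericSet J B = markedSet B (genericFamily J B) := by
  ext F
  constructor
  · rintro ⟨α, hα, rfl⟩
    exact ⟨α, hα, by dsimp only; rw [genericFamily_of_mem hα]; rfl⟩
  · rintro ⟨α, hα, rfl⟩
    exact ⟨α, hα, by dsimp only; rw [genericFamily_of_mem hα]; rfl⟩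

open Classical in
theorem coeff_generic {α : Exp n} (hα : α ∈ B) (δ : Exp n) :
    (genericFamily J B α).coeff δ = (if α = δ then 1 else 0) -
      if h : δ ∈ sousEscalierDeg J α.degree then X ⟨(α, δ), hα, h⟩ else 0 := by
  rw [genericFamily_of_mem hα, generic, coeff_sub, coeff_monomial, coeff_sum]
  simp only [coeff_monomial]
  congr 1
  split_ifs with h
  · rw [Finset.sum_eq_single_of_mem ⟨δ, h⟩ (Finset.mem_attach _ _)]
    · simp
    · rintro ⟨γ, hγ⟩ - hne
      rw [if_neg]
      rintro rfl
      exact hne rfl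
  · refine Finset.sum_eq_zero fun γ _ => if_neg ?_
    rintro rfl
    exact h γ.2

theorem notMem_sousEscalierDeg {α : Exp n} (hα : α ∈ monomialBasis J) (d : ℕ) :
    α ∉ sousEscalierDeg J d :=
  fun h => (mem_sousEscalierDeg.1 h).2 hα.1

theorem coeff_generic_param (hB : B ⊆ monomialBasis J) (c : Param J B) :
    (genericFamily J B c.1.1).coeff c.1.2 = -X c := by
  classical
  have hne : c.1.1 ≠ c.1.2 := fun h =>
    notMem_sousEscalierDeg (hB c.2.1) c.1.1.degree (by nth_rewrite 2 [h]; exact c.2.2)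
  rw [coeff_generic c.2.1, if_neg hne, dif_pos c.2.2, zero_sub]
  rfl

theorem isMarkedFamily_generic (hB : B ⊆ monomialBasis J) :
    IsMarkedFamily J B (genericFamily J B) := by
  classical
  intro α hα
  constructor
  · rw [coeff_generic hα, if_pos rfl, dif_neg (notMem_sousEscalierDeg (hB hα) _), sub_zero]
  · intro δ hne hδ
    by_contra h
    rw [coeff_generic hα, if_neg hne.symm, dif_neg h, sub_zero] at hδ
    exact hδ rfl

theorem IsMarkedFamily.map {A' : Type*} [CommRing A'] {f : Exp n → Poly n A}
    (hf : IsMarkedFamily J B f) (φ : A →+* A') :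
    IsMarkedFamily J B (fun α => map φ (f α)) := by
  intro α hα
  refine ⟨by rw [coeff_map, (hf α hα).1, φ.map_one], fun δ hne hδ => (hf α hα).2 δ hne ?_⟩
  rw [coeff_map] at hδ
  exact fun h => hδ (by rw [h, φ.map_zero])

theorem hom_ext_of_map_genericFamily (hB : B ⊆ monomialBasis J)
    {φ ψ : MvPolynomial (Param J B) K →+* A} (hC : ∀ a, φ (C a) = ψ (C a))
    (h : ∀ α ∈ B, ∀ γ, φ ((genericFamily J B α).coeff γ) = ψ ((genericFamily J B α).coeff γ)) :
    φ = ψ := by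
  refine ringHom_ext hC fun c => ?_
  have := h _ c.2.1 c.1.2
  rw [coeff_generic_param hB, φ.map_neg, ψ.map_neg, neg_inj] at this
  exact this

/-- The specialization of the parameters that turns the generic family into `f`. -/
def familyHom (J : Ideal (Poly n K)) (B : Set (Exp n)) (φ : K →+* A) (f : Exp n → Poly n A) :
    MvPolynomial (Param J B) K →+* A :=
  eval₂Hom φ fun c => -(f c.1.1).coeff c.1.2

theorem familyHom_X (φ : K →+* A) (f : Exp n → Poly n A) (c : Param J B) :
    familyHom J B φ f (X c) = -(f c.1.1).coeff c.1.2 :=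
  eval₂Hom_X' _ _ _

theorem map_familyHom (hB : B ⊆ monomialBasis J) (φ : K →+* A) {f : Exp n → Poly n A}
    (hf : IsMarkedFamily J B f) {α : Exp n} (hα : α ∈ B) :
    map (familyHom J B φ f) (genericFamily J B α) = f α := by
  classical
  ext δ
  rw [coeff_map]
  by_cases hne : δ = α
  · subst hne
    rw [(isMarkedFamily_generic hB δ hα).1, (hf δ hα).1, map_one]
  · by_cases h : δ ∈ sousEscalierDeg J α.degree
    · obtain ⟨c, hc⟩ : ∃ c : Param J B, c.1 = (α, δ) := ⟨⟨(α, δ), hα, h⟩, rfl⟩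
      have h1 := coeff_generic_param hB c
      have h2 := familyHom_X φ f c
      rw [hc] at h1 h2
      rw [h1, map_neg, h2, neg_neg]
    · have h1 : (f α).coeff δ = 0 := by
        by_contra hcon
        exact h ((hf α hα).2 δ hne hcon)
      have h2 : (genericFamily J B α).coeff δ = 0 := by
        by_contra hcon
        exact h ((isMarkedFamily_generic hB α hα).2 δ hne hcon)
      rw [h1, h2, map_zero]

theorem isRestriction_id : IsRestriction (id : Exp n → Exp n) where
  add _ _ := rfl
  tsub _ _ := rfl
  sup _ _ := rfl
  le _ := le_rfl
  idem _ := rfl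
  single _ _ _ := rfl

theorem isRestriction_under : IsRestriction (under : Exp n → Exp n) where
  add := under_add
  tsub α β := by
    ext i
    simp only [under_apply, Finsupp.coe_tsub, Pi.sub_apply]
    split_ifs <;> rfl
  sup α β := by
    ext i
    simp only [under_apply, Finsupp.sup_apply]
    split_ifs <;> rfl
  le := under_le
  idem α := by
    ext i
    simp only [under_apply]
    split_ifs <;> rfl
  single α j hj := by
    ext i
    rw [under_apply]
    split_ifs with h
    · subst h
      have : j ≠ 0 := by
        rintro rfl
        simp [under_apply] at hj
      rw [Finsupp.single_eq_of_ne this.symm]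
    · rfl

theorem IsMarkedFamily.isSystem_id {f : Exp n → Poly n A}
    (hf : IsMarkedFamily J (monomialBasis J) f) : IsSystem id J (monomialBasis J) f where
  restr := isRestriction_id
  basis _ h := h
  injOn := Set.injOn_id _
  surj β h := ⟨β, h, rfl⟩
  coeff_head α h := (hf α h).1
  tail α h δ hne hδ := (mem_sousEscalierDeg.1 ((hf α h).2 δ hne hδ)).2

/-- `J` consists of the elements of degree at least `m` of `underIdeal J`. -/
def IsUnderTruncation (m : ℕ) (J : Ideal (Poly n K)) : Prop :=
  ∀ γ : Exp n, monomial γ (1 : K) ∈ J ↔ monomial γ (1 : K) ∈ underIdeal J ∧ m ≤ γ.degree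

/-- Generators of `J` have degree at least `m`, and in these degrees `J` and `underIdeal J` have the
same monomials. This puts the tails of the `F_α` outside `underIdeal J`. -/
theorem IsUnderTruncation.notMem {m : ℕ} (hJ : IsUnderTruncation m J) {α δ : Exp n}
    (hα : α ∈ monomialBasis J) (hδ : δ ∈ sousEscalierDeg J α.degree) :
    monomial δ (1 : K) ∉ underIdeal J := by
  intro h
  obtain ⟨hd, hN⟩ := mem_sousEscalierDeg.1 hδ
  exact hN ((hJ δ).2 ⟨h, hd ▸ ((hJ α).1 hα.1).2⟩)

theorem IsMarkedFamily.isSystem_under {m : ℕ} (hJ : IsUnderTruncation m J) {f : Exp n → Poly n A}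
    (hf : IsMarkedFamily J (superminimals J) f) :
    IsSystem under (underIdeal J) (superminimals J) f where
  restr := isRestriction_under
  basis _ h := h.2
  injOn := (under_injOn_monomialBasis J).mono (superminimals_subset J)
  surj _ h := exists_superminimal h
  coeff_head α h := (hf α h).1
  tail α h δ hne hδ := by
    rw [monomial_under_mem_iff]
    exact hJ.notMem h.1 ((hf α h).2 δ hne hδ)

theorem vStep_iff {f : Exp n → Poly n A} {h h₁ : Poly n A} :
    VStep (markedSet (monomialBasis J) f) h h₁ ↔
      ReductionStep (multiples id J (monomialBasis J) f) h h₁ := by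
  constructor
  · rintro ⟨_, ⟨α, hα, rfl⟩, δ, hst, hmem, rfl⟩
    refine ⟨_, ⟨α, hα, δ, ⟨rfl, hα, hst⟩, rfl⟩, ?_, ?_⟩
    · rwa [add_comm δ] at hmem
    · rw [← mul_assoc, C_mul_monomial, mul_one, add_comm α δ]
  · rintro ⟨_, ⟨α, hα, δ, hst, rfl⟩, hmem, rfl⟩
    refine ⟨_, ⟨α, hα, rfl⟩, δ, hst.2.2, ?_, ?_⟩
    · rwa [add_comm α δ] at hmem
    · rw [← mul_assoc, C_mul_monomial, mul_one, add_comm α δ]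

/-- As `x_0` is the least variable, its power in the tail never violates the star condition, so the
condition may be tested after applying `under`. Membership in `J` is automatic, the monomial being a
multiple of `x^α`. -/
theorem sgStep_iff {f : Exp n → Poly n A} {h h₁ : Poly n A} :
    SGStep J (markedSet (superminimals J) f) h h₁ ↔
      ReductionStep (multiples under (underIdeal J) (superminimals J) f) h h₁ := by
  constructor
  · rintro ⟨γ, hγ, -, _, ⟨α, hα, rfl⟩, η, ε, hst, heq, rfl⟩
    refine ⟨_, ⟨α, hα, ε, ⟨rfl, hα.2, fun i hi j hj => hst.2.2 i hi j ?_⟩, rfl⟩, ?_, ?_⟩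
    · have h1 := DFunLike.congr_fun (hst.1.symm.trans heq) j
      simp only [Finsupp.coe_add, Pi.add_apply] at h1
      rw [Finsupp.mem_support_iff, under_apply] at hj
      split_ifs at hj with h0
      · exact absurd rfl hj
      · rw [under_apply_of_ne h0] at h1
        rw [Finsupp.mem_support_iff]
        omega
    · exact heq ▸ hγ
    · rw [← mul_assoc, C_mul_monomial, mul_one, heq]
  · rintro ⟨_, ⟨α, hα, ε, hst, rfl⟩, hmem, rfl⟩
    refine ⟨α + ε, hmem, monomial_mem_of_le hα.1.1 le_self_add, _, ⟨α, hα, rfl⟩,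
      ε + Finsupp.single 0 (α 0), ε, ⟨?_, hα.2, fun i hi j hj => ?_⟩, rfl, ?_⟩
    · change α + ε = under α + _
      conv_lhs => rw [← under_add_single α]
      abel
    · by_cases h0 : j = 0
      · rw [h0]
        exact Fin.zero_le _
      · refine hst.2.2 i hi j ?_
        rw [Finsupp.mem_support_iff] at hj ⊢
        rw [under_apply_of_ne h0]
        rwa [Finsupp.add_apply, Finsupp.single_eq_of_ne h0, add_zero] at hj
    · rw [← mul_assoc, C_mul_monomial, mul_one]

theorem under_eq_zero_iff {τ : Exp n} : under τ = 0 ↔ ∃ t : ℕ, τ = Finsupp.single 0 t := by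
  constructor
  · intro h
    refine ⟨τ 0, ?_⟩
    conv_lhs => rw [← under_add_single τ, h, zero_add]
  · rintro ⟨t, rfl⟩
    exact under_single_zero t

theorem X_zero_pow_eq (t : ℕ) : (X 0 ^ t : Poly n A) = monomial (Finsupp.single 0 t) 1 := by
  rw [X_pow_eq_monomial]

/-- A monomial of `underIdeal J` becomes a head after multiplication by a power of `x_0`; conversely
heads lie in `underIdeal J`, where powers of `x_0` may be cancelled. -/
theorem stronglyReduced_iff {m : ℕ} (hss : IsStronglyStable J) (hJ : IsUnderTruncation m J)
    {f : Exp n → Poly n A} (hf : IsMarkedFamily J (superminimals J) f) {h : Poly n A} :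
    StronglyReduced J (markedSet (superminimals J) f) h ↔
      ∀ γ ∈ h.support, monomial γ (1 : K) ∉ underIdeal J := by
  have hS := hf.isSystem_under hJ
  constructor
  · intro hred γ hγ hmem
    obtain ⟨τ, hτ, q, hq, hqh⟩ :=
      hS.exists_multiple hss.underIdeal.hasStars (monomial_under_mem_iff.2 hmem)
    obtain ⟨t, rfl⟩ := under_eq_zero_iff.1 hτ
    refine hred t _ (sgStep_iff.2 ⟨q, hq, ?_, rfl⟩)
    rw [X_zero_pow_eq, hqh, mem_support_iff, coeff_monomial_mul, one_mul]
    exact mem_support_iff.1 hγ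
  · intro hred t h₁ hstep
    obtain ⟨_, ⟨α, hα, ε, hst, rfl⟩, hmem, -⟩ := sgStep_iff.1 hstep
    rw [X_zero_pow_eq, mem_support_iff] at hmem
    obtain ⟨δ, hδ, hδne⟩ := exists_of_coeff_monomial_mul_ne_zero hmem
    refine hred δ (mem_support_iff.2 hδne) (monomial_under_mem_iff.1 ?_)
    have := hst.mem
    change α + ε = _ at hδ
    rwa [← under_add, hδ, under_add, under_single_zero, zero_add] at this

/-- Needed so that the polynomials recovered from strong reducts have tails in the degree of their
heads. -/
theorem IsMarkedFamily.homogeneous_of_reduces {f : Exp n → Poly n A}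
    {u : Exp n → Exp n} {I : Ideal (Poly n K)} (hf : IsMarkedFamily J B f) {d : ℕ}
    {h R : Poly n A} (hR : Relation.ReflTransGen (ReductionStep (multiples u I B f)) h R)
    (hd : ∀ γ ∈ h.support, γ.degree = d) : ∀ γ ∈ R.support, γ.degree = d := by
  induction hR with
  | refl => exact hd
  | @tail b _ _ hs ih =>
    obtain ⟨_, ⟨α, hα, ε, -, rfl⟩, hmem, rfl⟩ := hs
    have hdeg := ih _ hmem
    intro γ hγ
    by_contra hcon
    have h0 : b.coeff γ = 0 := notMem_support_iff.1 (fun h => hcon (ih γ h))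
    rw [mem_support_iff, coeff_sub, h0, coeff_C_mul, zero_sub, neg_ne_zero] at hγ
    obtain ⟨δ, rfl, hδ⟩ := exists_of_coeff_monomial_mul_ne_zero (right_ne_zero_of_mul hγ)
    change (α + ε).degree = d at hdeg
    have hδα : δ.degree = α.degree := by
      by_cases he : δ = α
      · rw [he]
      · exact (mem_sousEscalierDeg.1 ((hf α hα).2 δ he hδ)).1
    rw [map_add] at hcon hdeg
    omega

end Families

/-! ### Marked bases, and extension from the superminimal generators. -/

section Bases

variable {n : ℕ} {K : Type*} [Field K] {A : Type*} [CommRing A] {J : Ideal (Poly n K)}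

/-- The monomials outside `J` are linearly independent modulo the ideal generated by the `f α`. -/
def IsMarkedBasis (J : Ideal (Poly n K)) (f : Exp n → Poly n A) : Prop :=
  ∀ h ∈ Ideal.span (f '' monomialBasis J), IsReduced J h → h = 0

theorem isReduced_sub {h h' : Poly n A} (hh : IsReduced J h) (hh' : IsReduced J h') :
    IsReduced J (h - h') := by
  intro γ hγ
  by_contra hcon
  have h1 : h.coeff γ = 0 := notMem_support_iff.1 fun hm => hcon (hh γ hm)
  have h2 : h'.coeff γ = 0 := notMem_support_iff.1 fun hm => hcon (hh' γ hm)
  rw [mem_support_iff, coeff_sub, h1, h2, sub_zero] at hγ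
  exact hγ rfl

theorem isReduced_map {A' : Type*} [CommRing A'] (φ : A →+* A') {h : Poly n A}
    (hh : IsReduced J h) : IsReduced J (map φ h) :=
  fun γ hγ => hh γ (support_map_subset φ h hγ)

theorem span_multiples_le {u : Exp n → Exp n} {I : Ideal (Poly n K)} {B B' : Set (Exp n)}
    {f : Exp n → Poly n A} (hB : B ⊆ B') {h : Poly n A}
    (hh : h ∈ Submodule.span A (Marked.poly '' multiples u I B f)) :
    h ∈ Ideal.span (f '' B') := by
  have : Submodule.span A (Marked.poly '' multiples u I B f) ≤
      (Ideal.span (f '' B')).restrictScalars A := by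
    refine Submodule.span_le.2 ?_
    rintro _ ⟨_, ⟨α, hα, ε, -, rfl⟩, rfl⟩
    exact Ideal.mul_mem_left _ _ (Ideal.subset_span ⟨α, hB hα, rfl⟩)
  exact this hh

theorem map_mem_span {A' : Type*} [CommRing A'] (φ : A →+* A') {B B' : Set (Exp n)}
    {f : Exp n → Poly n A} {f' : Exp n → Poly n A'} (hB : B ⊆ B')
    (hf : ∀ α ∈ B, map φ (f α) = f' α) {h : Poly n A} (hh : h ∈ Ideal.span (f '' B)) :
    map φ h ∈ Ideal.span (f' '' B') := by
  have := Ideal.mem_map_of_mem (MvPolynomial.map φ) hh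
  rw [Ideal.map_span] at this
  refine Ideal.span_mono ?_ this
  rintro _ ⟨_, ⟨α, hα, rfl⟩, rfl⟩
  exact ⟨α, hB hα, (hf α hα).symm⟩

theorem IsMarkedFamily.exists_vReduces (hss : IsStronglyStable J) {f : Exp n → Poly n A}
    (hf : IsMarkedFamily J (monomialBasis J) f) (h : Poly n A) :
    ∃ R, Relation.ReflTransGen (ReductionStep (multiples id J (monomialBasis J) f)) h R ∧
      IsReduced J R := by
  obtain ⟨τ, hτ, R, hR, hred⟩ := hf.isSystem_id.exists_reduces hss.hasStars h
  change τ = 0 at hτ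
  subst hτ
  rw [← C_apply, C_1, one_mul] at hR
  exact ⟨R, hR, hred⟩

theorem IsMarkedFamily.exists_isReduced (hss : IsStronglyStable J) {f : Exp n → Poly n A}
    (hf : IsMarkedFamily J (monomialBasis J) f) (h : Poly n A) :
    ∃ R, h - R ∈ Ideal.span (f '' monomialBasis J) ∧ IsReduced J R := by
  obtain ⟨R, hR, hred⟩ := hf.exists_vReduces hss h
  exact ⟨R, span_multiples_le subset_rfl (sub_mem_span_of_reduces hR), hred⟩

theorem sPoly_mem_span {B : Set (Exp n)} {f : Exp n → Poly n A} {α α' : Exp n} (hα : α ∈ B)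
    (hα' : α' ∈ B) : sPoly ⟨α, f α⟩ ⟨α', f α'⟩ ∈ Ideal.span (f '' B) :=
  sub_mem (Ideal.mul_mem_left _ _ (Ideal.subset_span ⟨α, hα, rfl⟩))
    (Ideal.mul_mem_left _ _ (Ideal.subset_span ⟨α', hα', rfl⟩))

/-- The reduced form of an S-polynomial lies in the ideal of the generic family. Its specialization
is a reduced element of the ideal of a marked basis, hence zero. -/
theorem IsMarkedBasis.map_eq_zero_of_mem_idealA {φ : MvPolynomial (ParamC J) K →+* A}
    (hb : IsMarkedBasis J fun α => map φ (genericFamily J (monomialBasis J) α)) :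
    ∀ c ∈ idealA J, φ c = 0 := by
  have : idealA J ≤ RingHom.ker φ := by
    refine Ideal.span_le.2 ?_
    rintro c ⟨F, hF, F', hF', R, hR, hred, hc⟩
    rw [genericSet_eq] at hF hF' hR
    obtain ⟨α, hα, rfl⟩ := hF
    obtain ⟨α', hα', rfl⟩ := hF'
    have hR' := Relation.ReflTransGen.mono (fun _ _ => vStep_iff.1) _ _ hR
    have hmem := sub_mem (sPoly_mem_span (f := genericFamily J (monomialBasis J)) hα hα')
      (span_multiples_le subset_rfl (sub_mem_span_of_reduces hR'))
    rw [sub_sub_cancel] at hmem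
    have h0 := hb _ (map_mem_span φ subset_rfl (fun _ _ => rfl) hmem) (isReduced_map φ hred)
    obtain ⟨γ, -, rfl⟩ := mem_coeffs_iff.1 hc
    have := congrArg (coeff γ) h0
    rwa [coeff_map, coeff_zero] at this
  exact fun c hc => this hc

/-- The Buchberger criterion for `u = id`: the S-polynomials of critical pairs reduce generically to
remainders that `φ` kills. -/
theorem isMarkedBasis_of_map_idealA (hss : IsStronglyStable J)
    {φ : MvPolynomial (ParamC J) K →+* A} (hφ : ∀ c ∈ idealA J, φ c = 0) :
    IsMarkedBasis J fun α => map φ (genericFamily J (monomialBasis J) α) := by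
  have hg := isMarkedFamily_generic (J := J) subset_rfl
  have hS := (hg.map φ).isSystem_id
  have hmul : ∀ α ∈ monomialBasis J, ∀ ε, _ := fun α hα ε =>
    hS.monomial_mul_mem_satSpan hss.hasStars (fun j α α' η hp => by
      obtain ⟨R, hR, hred⟩ := hg.exists_vReduces hss
        (sPoly ⟨α, genericFamily J (monomialBasis J) α⟩ ⟨α', genericFamily J (monomialBasis J) α'⟩)
      refine ⟨0, rfl, hg.isSystem_id.mem_span_smallMultiples hp φ (R := R) (fun _ _ => rfl) rfl
        (by rwa [← C_apply, C_1, one_mul]) ?_⟩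
      ext γ
      rw [coeff_map, coeff_zero]
      by_cases h0 : R.coeff γ = 0
      · rw [h0, map_zero]
      · refine hφ _ (Ideal.subset_span ?_)
        rw [genericSet_eq]
        exact ⟨_, ⟨α, hp.left, rfl⟩, _, ⟨α', hp.right, rfl⟩, R,
          Relation.ReflTransGen.mono (fun _ _ => vStep_iff.2) _ _ hR, hred,
          coeff_mem_coeffs γ h0⟩) hα ε
  intro h hh hred
  refine hS.eq_zero_of_mem_satSpan (hS.ideal_span_le_satSpan hmul ?_ hh) hred
  rintro _ ⟨α, hα, rfl⟩
  have := hmul α hα 0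
  rwa [← C_apply, C_1, one_mul] at this

/-- `x_0^t H` has a superminimal reduction to the strongly reduced polynomial `R`. -/
def IsStrongReduct (J : Ideal (Poly n K)) (sG : Set (Marked n A)) (H : Poly n A) (t : ℕ)
    (R : Poly n A) : Prop :=
  SGReduces J sG (X 0 ^ t * H) R ∧ StronglyReduced J sG R

theorem sgReduces_iff {f : Exp n → Poly n A} {h R : Poly n A} :
    SGReduces J (markedSet (superminimals J) f) h R ↔ Relation.ReflTransGen
      (ReductionStep (multiples under (underIdeal J) (superminimals J) f)) h R :=
  ⟨Relation.ReflTransGen.mono (fun _ _ => sgStep_iff.1) _ _,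
    Relation.ReflTransGen.mono (fun _ _ => sgStep_iff.2) _ _⟩

theorem exists_isStrongReduct {m : ℕ} (hss : IsStronglyStable J) (hJ : IsUnderTruncation m J)
    {f : Exp n → Poly n A} (hf : IsMarkedFamily J (superminimals J) f) (H : Poly n A) :
    ∃ t R, IsStrongReduct J (markedSet (superminimals J) f) H t R := by
  obtain ⟨τ, hτ, R, hR, hred⟩ :=
    (hf.isSystem_under hJ).exists_reduces hss.underIdeal.hasStars H
  obtain ⟨t, rfl⟩ := under_eq_zero_iff.1 hτ
  refine ⟨t, R, ?_, (stronglyReduced_iff hss hJ hf).2 fun γ hγ h => hred γ hγ ?_⟩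
  · rwa [sgReduces_iff, X_zero_pow_eq]
  · exact monomial_under_mem_iff.2 h

theorem isReduced_of_forall_notMem_underIdeal {h : Poly n A}
    (hh : ∀ γ ∈ h.support, monomial γ (1 : K) ∉ underIdeal J) : IsReduced J h :=
  fun γ hγ hm => hh γ hγ (mem_underIdeal_of_mem hm)

variable {m : ℕ} {φ : Coef J →+* A} {f : Exp n → Poly n A}

theorem sub_map_mem_of_sgReduces
    (hext : ∀ α ∈ superminimals J, f α = map φ (genericFamily J (superminimals J) α))
    {h R : Poly n (Coef J)} (hR : SGReduces J (genericSet J (superminimals J)) h R) :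
    map φ h - map φ R ∈ Ideal.span (f '' monomialBasis J) := by
  rw [genericSet_eq, sgReduces_iff] at hR
  rw [← map_sub]
  exact map_mem_span φ (superminimals_subset J) (fun α hα => (hext α hα).symm)
    (span_multiples_le subset_rfl (sub_mem_span_of_reduces hR))

/-- Both sides are congruent to `x_0^t x^α` modulo the ideal, and both are reduced: the tail of `f
α` avoids `underIdeal J`, so multiplication by `x_0^t` keeps it outside `J`. -/
theorem IsMarkedBasis.map_strongReduct_eq (hss : IsStronglyStable J)
    (hJ : IsUnderTruncation m J) (hf : IsMarkedFamily J (monomialBasis J) f)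
    (hb : IsMarkedBasis J f)
    (hext : ∀ α ∈ superminimals J, f α = map φ (genericFamily J (superminimals J) α))
    {α : Exp n} (hα : α ∈ monomialBasis J) {t : ℕ} {R : Poly n (Coef J)}
    (hR : IsStrongReduct J (genericSet J (superminimals J)) (monomial α 1) t R) :
    map φ R = X 0 ^ t * (monomial α 1 - f α) := by
  have h1 := sub_map_mem_of_sgReduces hext hR.1
  have hsr := hR.2
  rw [genericSet_eq,
    stronglyReduced_iff hss hJ (isMarkedFamily_generic (superminimals_subset J))] at hsr
  refine sub_eq_zero.1 (hb _ ?_ ?_)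
  · have h2 := Ideal.mul_mem_left (Ideal.span (f '' monomialBasis J)) (X 0 ^ t)
      (Ideal.subset_span ⟨α, hα, rfl⟩)
    have h3 := sub_mem h2 h1
    rw [map_mul, map_pow, map_X, map_monomial, φ.map_one] at h3
    convert h3 using 1
    ring
  · refine isReduced_sub (isReduced_map φ (isReduced_of_forall_notMem_underIdeal hsr))
      (isReduced_of_forall_notMem_underIdeal fun γ hγ hmem => ?_)
    rw [X_zero_pow_eq, mem_support_iff] at hγ
    obtain ⟨δ, rfl, hδ⟩ := exists_of_coeff_monomial_mul_ne_zero hγ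
    rw [← monomial_under_mem_iff, under_add, under_single_zero, zero_add,
      monomial_under_mem_iff] at hmem
    rw [coeff_sub, coeff_monomial] at hδ
    by_cases he : α = δ
    · subst he
      rw [if_pos rfl, (hf α hα).1, sub_self] at hδ
      exact hδ rfl
    · rw [if_neg he, zero_sub, neg_ne_zero] at hδ
      exact hJ.notMem hα ((hf α hα).2 δ (Ne.symm he) hδ) hmem

theorem IsMarkedBasis.map_strongReduct_sPoly (hss : IsStronglyStable J)
    (hJ : IsUnderTruncation m J) (hb : IsMarkedBasis J f)
    (hext : ∀ α ∈ superminimals J, f α = map φ (genericFamily J (superminimals J) α))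
    {F F' : Marked n (Coef J)} (hF : F ∈ genericSet J (superminimals J))
    (hF' : F' ∈ genericSet J (superminimals J)) {t : ℕ} {R : Poly n (Coef J)}
    (hR : IsStrongReduct J (genericSet J (superminimals J)) (sPoly F F') t R) :
    map φ R = 0 := by
  have h1 := sub_map_mem_of_sgReduces hext hR.1
  have hsr := hR.2
  rw [genericSet_eq] at hF hF'
  rw [genericSet_eq,
    stronglyReduced_iff hss hJ (isMarkedFamily_generic (superminimals_subset J))] at hsr
  obtain ⟨α, hα, rfl⟩ := hF
  obtain ⟨α', hα', rfl⟩ := hF'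
  have h2 := map_mem_span φ (superminimals_subset J) (fun α hα => (hext α hα).symm)
    (Ideal.mul_mem_left _ (X 0 ^ t) (sPoly_mem_span hα hα'))
  have h3 := sub_mem h2 h1
  rw [sub_sub_cancel] at h3
  exact hb _ h3 (isReduced_map φ (isReduced_of_forall_notMem_underIdeal hsr))

theorem X_pow_mul_cancel {t : ℕ} {h h' : Poly n A} (he : X 0 ^ t * h = X 0 ^ t * h') : h = h' := by
  ext δ
  have := congrArg (coeff (Finsupp.single 0 t + δ)) he
  rwa [X_zero_pow_eq, coeff_monomial_mul, coeff_monomial_mul, one_mul, one_mul] at this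

/-- A marked basis is determined by its superminimal elements. -/
theorem IsMarkedBasis.unique (hss : IsStronglyStable J) (hJ : IsUnderTruncation m J)
    {f' : Exp n → Poly n A} (hf : IsMarkedFamily J (monomialBasis J) f)
    (hf' : IsMarkedFamily J (monomialBasis J) f') (hb : IsMarkedBasis J f)
    (hb' : IsMarkedBasis J f')
    (hext : ∀ α ∈ superminimals J, f α = map φ (genericFamily J (superminimals J) α))
    (hext' : ∀ α ∈ superminimals J, f' α = map φ (genericFamily J (superminimals J) α)) :
    ∀ α ∈ monomialBasis J, f α = f' α := by
  intro α hα
  -- One strong reduct of `x^α`, computed from `s𝒢` alone, determines both `f α` and `f' α` after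
  -- cancelling `x_0^t`.
  obtain ⟨t, R, hR⟩ := exists_isStrongReduct hss hJ
    (isMarkedFamily_generic (superminimals_subset J)) (monomial α 1)
  rw [← genericSet_eq] at hR
  have := (hb.map_strongReduct_eq hss hJ hf hext hα hR).symm.trans
    (hb'.map_strongReduct_eq hss hJ hf' hext' hα hR)
  exact sub_right_inj.1 (X_pow_mul_cancel this)

/-- `φ` annihilates the equations found by the algorithm `markedScheme`. -/
structure KillsEquations (J : Ideal (Poly n K)) (φ : Coef J →+* A) : Prop where
  gens : ∀ α ∈ monomialBasis J \ superminimals J, ∃ t R,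
    IsStrongReduct J (genericSet J (superminimals J)) (monomial α 1) t R ∧
      ∀ c ∈ (R.modMonomial (Finsupp.single 0 t)).coeffs, φ c = 0
  pairs : ∀ p ∈ pairsL1 J (genericSet J (superminimals J)), ∃ t R,
    IsStrongReduct J (genericSet J (superminimals J)) (sPoly p.1 p.2) t R ∧
      ∀ c ∈ R.coeffs, φ c = 0

theorem map_eq_zero_of_coeffs {R : Poly n (Coef J)} (h : ∀ c ∈ R.coeffs, φ c = 0) :
    map φ R = 0 := by
  ext γ
  rw [coeff_map, coeff_zero]
  by_cases h0 : R.coeff γ = 0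
  · rw [h0, map_zero]
  · exact h _ (coeff_mem_coeffs γ h0)

theorem coeff_eq_zero_of_map {R : Poly n (Coef J)} (h : map φ R = 0) : ∀ c ∈ R.coeffs, φ c = 0 := by
  intro c hc
  obtain ⟨γ, -, rfl⟩ := mem_coeffs_iff.1 hc
  have := congrArg (coeff γ) h
  rwa [coeff_map, coeff_zero] at this

theorem degree_le_of_mem_span (hJ : IsUnderTruncation m J)
    (hf : IsMarkedFamily J (monomialBasis J) f) {h : Poly n A}
    (hh : h ∈ Ideal.span (f '' monomialBasis J)) : ∀ γ ∈ h.support, m ≤ γ.degree := by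
  have hle : Ideal.span (f '' monomialBasis J) ≤
      Ideal.span ((fun γ => monomial γ (1 : A)) '' {γ : Exp n | m ≤ γ.degree}) := by
    refine Ideal.span_le.2 ?_
    rintro _ ⟨α, hα, rfl⟩
    rw [SetLike.mem_coe, mem_ideal_span_monomial_image]
    intro δ hδ
    refine ⟨δ, ?_, le_rfl⟩
    change m ≤ δ.degree
    have hm := ((hJ α).1 hα.1).2
    by_cases he : δ = α
    · exact he ▸ hm
    · exact (mem_sousEscalierDeg.1 ((hf α hα).2 δ he (mem_support_iff.1 hδ))).1 ▸ hm
  intro γ hγ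
  obtain ⟨δ, hδ, hle⟩ := mem_ideal_span_monomial_image.1 (hle hh) γ hγ
  exact le_trans hδ (Finsupp.degree_mono hle)

/-- The ideal of `f` lives in degrees at least `m`, where avoiding `J` means avoiding `underIdeal
J`; triangularity of the superminimal system then applies. -/
theorem isMarkedBasis_of_mem_satSpan (hJ : IsUnderTruncation m J)
    (hf : IsMarkedFamily J (monomialBasis J) f) {g : Exp n → Poly n A}
    (hg : IsMarkedFamily J (superminimals J) g)
    (hmul : ∀ α ∈ superminimals J, ∀ ε, monomial ε 1 * g α ∈
      satSpan (underIdeal J) (superminimals J) g isRestriction_under)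
    (hmem : ∀ α ∈ monomialBasis J,
      f α ∈ satSpan (underIdeal J) (superminimals J) g isRestriction_under) :
    IsMarkedBasis J f := by
  intro h hh hred
  have hS := hg.isSystem_under hJ
  refine hS.eq_zero_of_mem_satSpan (hS.ideal_span_le_satSpan hmul ?_ hh) fun γ hγ hmem' => ?_
  · rintro _ ⟨α, hα, rfl⟩
    exact hmem α hα
  · exact hred γ hγ ((hJ γ).2 ⟨monomial_under_mem_iff.1 hmem',
      degree_le_of_mem_span hJ hf hh γ hγ⟩)

theorem map_mem_span_multiples {A' : Type*} [CommRing A'] (ψ : A →+* A') {u : Exp n → Exp n}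
    {I : Ideal (Poly n K)} {B : Set (Exp n)} {h : Poly n A}
    (hh : h ∈ Submodule.span A (Marked.poly '' multiples u I B f)) :
    map ψ h ∈ Submodule.span A' (Marked.poly '' multiples u I B fun α => map ψ (f α)) := by
  induction hh using Submodule.span_induction with
  | mem g hg =>
    obtain ⟨_, ⟨α, hα, ε, hst, rfl⟩, rfl⟩ := hg
    refine Submodule.subset_span ⟨_, ⟨α, hα, ε, hst, rfl⟩, ?_⟩
    rw [map_mul, map_monomial, ψ.map_one]
  | zero => simp
  | add g g' _ _ h h' => rw [map_add]; exact add_mem h h'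
  | smul a g _ h =>
    rw [← C_mul', map_mul, map_C, C_mul']
    exact Submodule.smul_mem _ _ h

/-- Solutions of the equations extend to marked bases. -/
theorem KillsEquations.exists_isMarkedBasis (hss : IsStronglyStable J)
    (hJ : IsUnderTruncation m J) (hφ : KillsEquations J φ) :
    ∃ f : Exp n → Poly n A, IsMarkedFamily J (monomialBasis J) f ∧ IsMarkedBasis J f ∧
      ∀ α ∈ superminimals J, f α = map φ (genericFamily J (superminimals J) α) := by
  classical
  have hgen := isMarkedFamily_generic (superminimals_subset J)
  have hg := hgen.map φ
  have hS := hg.isSystem_under hJ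
  -- The critical pairs for `u = under` belong to `L_1`, so the pair equations supply the Buchberger
  -- criterion.
  have hmul : ∀ α ∈ superminimals J, ∀ ε, _ := fun α hα ε =>
    hS.monomial_mul_mem_satSpan hss.underIdeal.hasStars (fun j α α' η hp => by
      obtain ⟨t, R, ⟨hR, -⟩, hc⟩ := hφ.pairs
        (⟨α, genericFamily J (superminimals J) α⟩, ⟨α', genericFamily J (superminimals J) α'⟩)
        ⟨by rw [genericSet_eq]; exact ⟨α, hp.left, rfl⟩,
          by rw [genericSet_eq]; exact ⟨α', hp.right, rfl⟩, j, η, hp.star⟩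
      rw [genericSet_eq, sgReduces_iff, X_zero_pow_eq] at hR
      exact ⟨Finsupp.single 0 t, under_single_zero t,
        (hgen.isSystem_under hJ).mem_span_smallMultiples hp φ (fun _ _ => rfl)
          (under_single_zero t) hR (map_eq_zero_of_coeffs hc)⟩) hα ε
  -- Superminimal members are prescribed by `φ`; the other generators are recovered from their
  -- strong reducts. Outside `B_J` the value is irrelevant.
  have key : ∀ α : Exp n, ∃ p : Poly n A, α ∈ monomialBasis J →
      (α ∈ superminimals J → p = map φ (genericFamily J (superminimals J) α)) ∧
      p ∈ satSpan (underIdeal J) (superminimals J)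
        (fun α => map φ (genericFamily J (superminimals J) α)) isRestriction_under ∧
      p.coeff α = 1 ∧ ∀ δ, δ ≠ α → p.coeff δ ≠ 0 → δ ∈ sousEscalierDeg J α.degree := by
    intro α
    by_cases hα : α ∈ monomialBasis J
    swap
    · exact ⟨0, fun h => absurd h hα⟩
    by_cases hs : α ∈ superminimals J
    · refine ⟨_, fun _ => ⟨fun _ => rfl, ?_, hg α hs⟩⟩
      have := hmul α hs 0
      rwa [← C_apply, C_1, one_mul] at this
    obtain ⟨t, R, ⟨hR, hred⟩, hc⟩ := hφ.gens α ⟨hα, hs⟩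
    rw [genericSet_eq, sgReduces_iff, X_zero_pow_eq] at hR
    rw [genericSet_eq, stronglyReduced_iff hss hJ hgen] at hred
    set Q := R.divMonomial (Finsupp.single 0 t) with hQ
    -- The equations from `H'` say precisely that the specialized reduct is divisible by `x_0^t`.
    have hmap : map φ R = monomial (Finsupp.single 0 t) 1 * map φ Q := by
      conv_lhs => rw [← divMonomial_add_modMonomial R (Finsupp.single 0 t)]
      rw [map_add, map_eq_zero_of_coeffs hc, add_zero, map_mul, map_monomial, φ.map_one]
    have hsupp : ∀ δ, Q.coeff δ ≠ 0 → δ ∈ sousEscalierDeg J α.degree := by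
      intro δ hδ
      rw [hQ, coeff_divMonomial] at hδ
      have h1 := hred _ (mem_support_iff.2 hδ)
      have h2 := hgen.homogeneous_of_reduces hR (d := t + α.degree) (fun γ hγ => by
        obtain ⟨δ', rfl, hδ'⟩ := exists_of_coeff_monomial_mul_ne_zero (mem_support_iff.1 hγ)
        rw [coeff_monomial] at hδ'
        have : α = δ' := by
          by_contra hne
          exact hδ' (if_neg hne)
        rw [map_add, Finsupp.degree_single, this]) _ (mem_support_iff.2 hδ)
      rw [map_add, Finsupp.degree_single] at h2
      refine mem_sousEscalierDeg.2 ⟨by omega, fun hmem => h1 ?_⟩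
      exact mem_underIdeal_of_mem (monomial_mem_of_le hmem le_add_self)
    have hsupp' : ∀ δ, (map φ Q).coeff δ ≠ 0 → δ ∈ sousEscalierDeg J α.degree := by
      intro δ hδ
      rw [coeff_map] at hδ
      exact hsupp δ fun h => hδ (by rw [h, φ.map_zero])
    refine ⟨monomial α 1 - map φ Q, fun _ => ⟨fun h => absurd h hs, ?_, ?_, ?_⟩⟩
    · refine ⟨Finsupp.single 0 t, under_single_zero t, ?_⟩
      have := map_mem_span_multiples φ (sub_mem_span_of_reduces hR)
      rwa [map_sub, hmap, map_mul, map_monomial, map_monomial, φ.map_one, ← mul_sub] at this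
    · have h0 : (map φ Q).coeff α = 0 := by
        by_contra hcon
        exact notMem_sousEscalierDeg hα _ (hsupp' α hcon)
      rw [coeff_sub, coeff_monomial, if_pos rfl, h0, sub_zero]
    · intro δ hne hδ
      rw [coeff_sub, coeff_monomial, if_neg hne.symm, zero_sub, neg_ne_zero] at hδ
      exact hsupp' δ hδ
  choose f hf using key
  have hfam : IsMarkedFamily J (monomialBasis J) f := fun α hα => (hf α hα).2.2
  exact ⟨f, hfam, isMarkedBasis_of_mem_satSpan hJ hfam hg hmul fun α hα => (hf α hα).2.1,
    fun α hα => (hf α hα.1).1 hα⟩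

end Bases

/-! ### Comparison of the equations found with `𝔄̃_J`. -/

section Equations

variable {n : ℕ} {K : Type*} [Field K] {A : Type*} [CommRing A] {J : Ideal (Poly n K)} {m : ℕ}

theorem IsMarkedBasis.congr {f f' : Exp n → Poly n A} (hb : IsMarkedBasis J f)
    (h : ∀ α ∈ monomialBasis J, f α = f' α) : IsMarkedBasis J f' := by
  rw [IsMarkedBasis, ← Set.image_congr h]
  exact hb

theorem inclRing_coeff {α : Exp n} (hα : α ∈ superminimals J) (γ : Exp n) :
    inclRing J ((genericFamily J (superminimals J) α).coeff γ) =
      (genericFamily J (monomialBasis J) α).coeff γ := by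
  classical
  rw [coeff_generic hα, coeff_generic hα.1, map_sub]
  congr 1
  · split_ifs <;> simp
  · split_ifs
    · exact rename_X (inclParam J) _
    · rw [map_zero]

/-- A marked basis over `A` is a solution of the equations in `idealAt J`. -/
theorem IsMarkedBasis.map_eq_zero_of_mem_idealAt {φ : Coef J →+* A} {f : Exp n → Poly n A}
    (hf : IsMarkedFamily J (monomialBasis J) f) (hb : IsMarkedBasis J f)
    (hext : ∀ α ∈ superminimals J, f α = map φ (genericFamily J (superminimals J) α)) :
    ∀ e ∈ idealAt J, φ e = 0 := by
  -- The coefficients of `f` define a point of `K[C]` that kills `𝔄_J` and restricts to `φ` on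
  -- `K[C̃]`.
  set ψ := familyHom J (monomialBasis J) (φ.comp C) f with hψ
  have hψf : ∀ α ∈ monomialBasis J, map ψ (genericFamily J (monomialBasis J) α) = f α :=
    fun α hα => map_familyHom subset_rfl _ hf hα
  have hcomp : ψ.comp (inclRing J : Coef J →+* MvPolynomial (ParamC J) K) = φ := by
    refine hom_ext_of_map_genericFamily (superminimals_subset J) (fun a => ?_) fun α hα γ => ?_
    · simp [hψ, inclRing, familyHom]
    · have h1 := congrArg (coeff γ) ((hψf α hα.1).trans (hext α hα))
      rw [coeff_map, coeff_map] at h1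
      rw [← h1, ← inclRing_coeff hα]
      rfl
  intro e he
  rw [← hcomp]
  exact (hb.congr fun α hα => (hψf α hα).symm).map_eq_zero_of_mem_idealA _ he

theorem KillsEquations.map_eq_zero_of_mem_idealAt (hss : IsStronglyStable J)
    (hJ : IsUnderTruncation m J) {φ : Coef J →+* A} (hφ : KillsEquations J φ) :
    ∀ e ∈ idealAt J, φ e = 0 := by
  obtain ⟨f, hf, hb, hext⟩ := hφ.exists_isMarkedBasis hss hJ
  exact hb.map_eq_zero_of_mem_idealAt hf hext

/-- The map `K[C̃] → K[C]/𝔄_J`. -/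
abbrev toQuotient (J : Ideal (Poly n K)) : Coef J →+* MvPolynomial (ParamC J) K ⧸ idealA J :=
  (Ideal.Quotient.mk (idealA J)).comp (inclRing J : Coef J →+* MvPolynomial (ParamC J) K)

/-- The universal marked family. -/
abbrev universalFamily (J : Ideal (Poly n K)) :
    Exp n → Poly n (MvPolynomial (ParamC J) K ⧸ idealA J) :=
  fun α => map (Ideal.Quotient.mk (idealA J)) (genericFamily J (monomialBasis J) α)

theorem isMarkedFamily_universal (J : Ideal (Poly n K)) :
    IsMarkedFamily J (monomialBasis J) (universalFamily J) :=
  (isMarkedFamily_generic subset_rfl).map _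

theorem isMarkedBasis_universal (hss : IsStronglyStable J) :
    IsMarkedBasis J (universalFamily J) :=
  isMarkedBasis_of_map_idealA hss fun _ hc => Ideal.Quotient.eq_zero_iff_mem.2 hc

theorem universalFamily_superminimal {α : Exp n} (hα : α ∈ superminimals J) :
    universalFamily J α = map (toQuotient J) (genericFamily J (superminimals J) α) := by
  ext γ
  rw [coeff_map, coeff_map, ← inclRing_coeff hα]
  rfl

theorem toQuotient_eq_zero_iff {e : Coef J} : toQuotient J e = 0 ↔ e ∈ idealAt J :=
  Ideal.Quotient.eq_zero_iff_mem

/-- Over `K[C]/𝔄_J` the reduct is `x_0^t (x^α - F_α)`, so the coefficients at monomials not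
divisible by `x_0^t` vanish there. -/
theorem mem_idealAt_of_strongReduct (hss : IsStronglyStable J) (hJ : IsUnderTruncation m J)
    {α : Exp n} (hα : α ∈ monomialBasis J) {t : ℕ} {R : Poly n (Coef J)}
    (hR : IsStrongReduct J (genericSet J (superminimals J)) (monomial α 1) t R) :
    ∀ c ∈ (R.modMonomial (Finsupp.single 0 t)).coeffs, c ∈ idealAt J := by
  have hmap := (isMarkedBasis_universal hss).map_strongReduct_eq hss hJ
    (isMarkedFamily_universal J) (fun _ h => universalFamily_superminimal h) hα hR
  intro c hc
  obtain ⟨γ, hγ, rfl⟩ := mem_coeffs_iff.1 hc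
  by_cases hle : Finsupp.single 0 t ≤ γ
  · rw [coeff_modMonomial_of_le _ hle]
    exact zero_mem _
  · rw [coeff_modMonomial_of_not_le _ hle, ← toQuotient_eq_zero_iff, ← coeff_map, hmap,
      X_zero_pow_eq, coeff_monomial_mul', if_neg hle]

theorem mem_idealAt_of_strongReduct_sPoly (hss : IsStronglyStable J)
    (hJ : IsUnderTruncation m J) {F F' : Marked n (Coef J)}
    (hF : F ∈ genericSet J (superminimals J)) (hF' : F' ∈ genericSet J (superminimals J))
    {t : ℕ} {R : Poly n (Coef J)}
    (hR : IsStrongReduct J (genericSet J (superminimals J)) (sPoly F F') t R) :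
    ∀ c ∈ R.coeffs, c ∈ idealAt J := by
  have hmap := (isMarkedBasis_universal hss).map_strongReduct_sPoly hss hJ
    (fun _ h => universalFamily_superminimal h) hF hF' hR
  intro c hc
  exact toQuotient_eq_zero_iff.1 (coeff_eq_zero_of_map hmap c hc)

theorem killsEquations_of_idealAt (hss : IsStronglyStable J) (hJ : IsUnderTruncation m J)
    {φ : Coef J →+* A} (hφ : ∀ e ∈ idealAt J, φ e = 0) : KillsEquations J φ where
  gens α hα := by
    obtain ⟨t, R, hR⟩ := exists_isStrongReduct hss hJ
      (isMarkedFamily_generic (superminimals_subset J)) (monomial α 1)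
    rw [← genericSet_eq] at hR
    exact ⟨t, R, hR, fun c hc => hφ c (mem_idealAt_of_strongReduct hss hJ hα.1 hR c hc)⟩
  pairs p hp := by
    obtain ⟨t, R, hR⟩ := exists_isStrongReduct hss hJ
      (isMarkedFamily_generic (superminimals_subset J)) (sPoly p.1 p.2)
    rw [← genericSet_eq] at hR
    exact ⟨t, R, hR, fun c hc =>
      hφ c (mem_idealAt_of_strongReduct_sPoly hss hJ hp.1 hp.2.1 hR c hc)⟩

/-- `C_{αγ}` is the coefficient of `x^γ` in `x^α - F_α`, hence the class of the coefficient of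
`x_0^t x^γ` in a strong reduct of `x^α`, which lies in `K[C̃]`. -/
theorem toQuotient_surjective (hss : IsStronglyStable J) (hJ : IsUnderTruncation m J) :
    Function.Surjective (toQuotient J) := by
  intro y
  obtain ⟨p, rfl⟩ := Ideal.Quotient.mk_surjective y
  rw [← RingHom.mem_range]
  induction p using MvPolynomial.induction_on with
  | C a => exact ⟨C a, by simp [inclRing]⟩
  | add p q hp hq => rw [map_add]; exact add_mem hp hq
  | mul_X p c hp =>
    rw [map_mul]
    refine mul_mem hp ?_
    obtain ⟨t, R, hR⟩ := exists_isStrongReduct hss hJ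
      (isMarkedFamily_generic (superminimals_subset J)) (monomial c.1.1 1)
    rw [← genericSet_eq] at hR
    have hmap := (isMarkedBasis_universal hss).map_strongReduct_eq hss hJ
      (isMarkedFamily_universal J) (fun _ h => universalFamily_superminimal h) c.2.1 hR
    refine ⟨R.coeff (Finsupp.single 0 t + c.1.2), ?_⟩
    have hne : c.1.1 ≠ c.1.2 := fun h =>
      notMem_sousEscalierDeg c.2.1 c.1.1.degree (by nth_rewrite 2 [h]; exact c.2.2)
    rw [← coeff_map, hmap, X_zero_pow_eq, coeff_monomial_mul, one_mul, coeff_sub, coeff_map,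
      coeff_generic_param subset_rfl c, map_neg, sub_neg_eq_add]
    classical
    rw [coeff_monomial, if_neg hne, zero_add]

end Equations

/-! ### The ideals of `Mf(J)` as marked bases over `K`. -/

section Points

variable {n : ℕ} {K : Type*} [Field K] {J : Ideal (Poly n K)} {m : ℕ}

/-- The monomials outside `J`. -/
def outsideMonomial (J : Ideal (Poly n K)) (γ : sousEscalier J) : Poly n K :=
  monomial (γ : Exp n) 1

theorem mem_span_outside_iff {h : Poly n K} :
    h ∈ Submodule.span K (Set.range (outsideMonomial J)) ↔ IsReduced J h := by
  constructor
  · intro hh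
    induction hh using Submodule.span_induction with
    | mem g hg =>
      obtain ⟨γ, rfl⟩ := hg
      exact forall_mem_support_monomial.2 γ.2
    | zero => intro γ hγ; simp at hγ
    | add g g' _ _ h h' =>
      have := isReduced_sub h (isReduced_sub (h := 0) (fun γ hγ => by simp at hγ) h')
      simpa using this
    | smul a g _ h => exact fun γ hγ => h γ (support_smul hγ)
  · intro hh
    rw [← support_sum_monomial_coeff h]
    refine sum_mem fun γ hγ => ?_
    have : monomial γ (h.coeff γ) = h.coeff γ • outsideMonomial J ⟨γ, hh γ hγ⟩ := by
      rw [outsideMonomial, smul_monomial, smul_eq_mul, mul_one]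
    rw [this]
    exact Submodule.smul_mem _ _ (Submodule.subset_span ⟨_, rfl⟩)

theorem linearIndependent_outside (J : Ideal (Poly n K)) :
    LinearIndependent K (outsideMonomial J) := by
  have := (basisMonomials (Fin (n + 1)) K).linearIndependent.comp
    (fun γ : sousEscalier J => (γ : Exp n)) Subtype.val_injective
  rw [coe_basisMonomials] at this
  exact this

theorem mem_markedFamily_iff {I : Ideal (Poly n K)} : I ∈ markedFamily J ↔
    (∀ f ∈ I, ∀ d : ℕ, homogeneousComponent d f ∈ I) ∧
      (∀ h ∈ I, IsReduced J h → h = 0) ∧ ∀ h, ∃ R, h - R ∈ I ∧ IsReduced J R := by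
  set L : Poly n K →ₗ[K] Poly n K ⧸ I := (Ideal.Quotient.mkₐ K I).toLinearMap with hL
  have hLmem : ∀ h, L h = 0 ↔ h ∈ I := fun h => Ideal.Quotient.eq_zero_iff_mem
  have hLs : Function.Surjective L := Ideal.Quotient.mk_surjective
  change _ ∧ LinearIndependent K (L ∘ outsideMonomial J) ∧
    Submodule.span K (Set.range (L ∘ outsideMonomial J)) = ⊤ ↔ _
  refine and_congr_right fun _ => and_congr ⟨fun hli h hh hred => ?_, fun hI => ?_⟩ ?_
  · obtain ⟨l, rfl⟩ :=
      Finsupp.mem_span_range_iff_exists_finsupp.1 (mem_span_outside_iff.2 hred)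
    rw [linearIndependent_iff] at hli
    have h0 := (hLmem _).2 hh
    rw [hli l (by rw [← h0, map_finsuppSum, Finsupp.linearCombination_apply]; simp)]
    simp
  · refine (linearIndependent_outside J).map (Submodule.disjoint_def.2 fun h hh hk => ?_)
    exact hI h ((hLmem h).1 hk) (mem_span_outside_iff.1 hh)
  · rw [Set.range_comp, ← Submodule.map_span, Submodule.eq_top_iff']
    constructor
    · intro htop h
      obtain ⟨R, hR, he⟩ := htop (L h)
      exact ⟨R, (hLmem _).1 (by rw [map_sub, he, sub_self]), mem_span_outside_iff.1 hR⟩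
    · intro hex y
      obtain ⟨h, rfl⟩ := hLs y
      obtain ⟨R, hR, hred⟩ := hex h
      refine ⟨R, mem_span_outside_iff.2 hred, ?_⟩
      have := (hLmem _).2 hR
      rw [map_sub, sub_eq_zero] at this
      exact this.symm

theorem IsMarkedFamily.isHomogeneous {f : Exp n → Poly n K}
    (hf : IsMarkedFamily J (monomialBasis J) f) {α : Exp n} (hα : α ∈ monomialBasis J) :
    (f α).IsHomogeneous α.degree := by
  intro δ hδ
  have hw : Finsupp.weight 1 δ = δ.degree := by
    rw [Finsupp.degree_eq_weight_one]
    rfl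
  rw [hw]
  by_cases he : δ = α
  · rw [he]
  · exact (mem_sousEscalierDeg.1 ((hf α hα).2 δ he hδ)).1

attribute [local instance] MvPolynomial.gradedAlgebra in
theorem homogeneousComponent_mem_span {s : Set (Poly n K)}
    (hs : ∀ g ∈ s, ∃ d, g.IsHomogeneous d) {h : Poly n K} (hh : h ∈ Ideal.span s) (d : ℕ) :
    homogeneousComponent d h ∈ Ideal.span s := by
  have hI := Ideal.homogeneous_span (homogeneousSubmodule (Fin (n + 1)) K) s fun g hg => by
    obtain ⟨d, hd⟩ := hs g hg
    exact ⟨d, hd⟩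
  have := hI d hh
  rwa [← decomposition.decompose'_apply]

theorem IsMarkedBasis.span_mem_markedFamily (hss : IsStronglyStable J) {f : Exp n → Poly n K}
    (hf : IsMarkedFamily J (monomialBasis J) f) (hb : IsMarkedBasis J f) :
    Ideal.span (f '' monomialBasis J) ∈ markedFamily J := by
  refine mem_markedFamily_iff.2 ⟨fun h hh d => homogeneousComponent_mem_span ?_ hh d, hb,
    hf.exists_isReduced hss⟩
  rintro _ ⟨α, hα, rfl⟩
  exact ⟨_, hf.isHomogeneous hα⟩

theorem exists_markedBasis_of_mem_markedFamily (hss : IsStronglyStable J) {I : Ideal (Poly n K)}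
    (hI : I ∈ markedFamily J) : ∃ f : Exp n → Poly n K, IsMarkedFamily J (monomialBasis J) f ∧
      IsMarkedBasis J f ∧ I = Ideal.span (f '' monomialBasis J) := by
  classical
  obtain ⟨hhom, hind, hex⟩ := mem_markedFamily_iff.1 hI
  choose R hR hred using fun α : Exp n => hex (monomial α 1)
  -- The chosen normal form `R α` need not be homogeneous; homogeneity of `I` allows passing to the
  -- component of degree `|α|`, which still has head `x^α`.
  set f : Exp n → Poly n K :=
    fun α => homogeneousComponent α.degree (monomial α 1 - R α) with hf_def
  have hfI : ∀ α, f α ∈ I := fun α => hhom _ (hR α) _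
  have hle : Ideal.span (f '' monomialBasis J) ≤ I := by
    refine Ideal.span_le.2 ?_
    rintro _ ⟨α, -, rfl⟩
    exact hfI α
  have hf : IsMarkedFamily J (monomialBasis J) f := by
    intro α hα
    have h0 : (R α).coeff α = 0 := by
      by_contra hcon
      exact hred α α (mem_support_iff.2 hcon) hα.1
    refine ⟨?_, fun δ hne hδ => ?_⟩
    · rw [hf_def, coeff_homogeneousComponent, if_pos rfl, coeff_sub, h0, coeff_monomial,
        if_pos rfl, sub_zero]
    · rw [hf_def, coeff_homogeneousComponent] at hδ
      split_ifs at hδ with hd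
      · rw [coeff_sub, coeff_monomial, if_neg hne.symm, zero_sub, neg_ne_zero] at hδ
        exact mem_sousEscalierDeg.2 ⟨hd, hred α δ (mem_support_iff.2 hδ)⟩
      · exact absurd rfl hδ
  refine ⟨f, hf, fun h hh => hind h (hle hh), le_antisymm (fun h hh => ?_) hle⟩
  obtain ⟨R', hR', hred'⟩ := hf.exists_isReduced hss h
  have h1 := sub_mem hh (hle hR')
  rw [sub_sub_cancel] at h1
  rwa [hind R' h1 hred', sub_zero] at hR'

/-- The heads cancel in the difference, which is therefore a reduced element of `I`. -/
theorem eq_of_mem_markedFamily {B : Set (Exp n)} {I : Ideal (Poly n K)} (hI : I ∈ markedFamily J)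
    {f f' : Exp n → Poly n K} (hf : IsMarkedFamily J B f) (hf' : IsMarkedFamily J B f') {α : Exp n}
    (hα : α ∈ B) (h : f α ∈ I) (h' : f' α ∈ I) : f α = f' α := by
  refine sub_eq_zero.1 ((mem_markedFamily_iff.1 hI).2.1 _ (sub_mem h h') fun δ hδ => ?_)
  rw [mem_support_iff, coeff_sub] at hδ
  have hne : δ ≠ α := by
    rintro rfl
    rw [(hf δ hα).1, (hf' δ hα).1, sub_self] at hδ
    exact hδ rfl
  by_cases h0 : (f α).coeff δ = 0
  · rw [h0, zero_sub, neg_ne_zero] at hδ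
    exact (mem_sousEscalierDeg.1 ((hf' α hα).2 δ hne hδ)).2
  · exact (mem_sousEscalierDeg.1 ((hf α hα).2 δ hne h0)).2

theorem IsMarkedFamily.mono {A : Type*} [CommRing A] {B B' : Set (Exp n)} (hB : B ⊆ B')
    {f : Exp n → Poly n A} (hf : IsMarkedFamily J B' f) : IsMarkedFamily J B f :=
  fun α hα => hf α (hB hα)

theorem forall_specialize_mem_iff {c : ParamCt J → K} {I : Ideal (Poly n K)} :
    (∀ F ∈ genericSet J (superminimals J), specialize c F.poly ∈ I) ↔
      ∀ α ∈ superminimals J, map (eval c) (genericFamily J (superminimals J) α) ∈ I := by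
  rw [genericSet_eq]
  exact Set.forall_mem_image

theorem existsUnique_ideal_of_zero (hss : IsStronglyStable J) (hJ : IsUnderTruncation m J)
    (c : ParamCt J → K) (hc : ∀ e ∈ idealAt J, eval c e = 0) :
    ∃! I : Ideal (Poly n K), I ∈ markedFamily J ∧
      ∀ F ∈ genericSet J (superminimals J), specialize c F.poly ∈ I := by
  obtain ⟨f, hf, hb, hext⟩ := (killsEquations_of_idealAt hss hJ hc).exists_isMarkedBasis hss hJ
  refine ⟨Ideal.span (f '' monomialBasis J), ⟨hb.span_mem_markedFamily hss hf, ?_⟩, ?_⟩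
  · refine forall_specialize_mem_iff.2 fun α hα => ?_
    rw [← hext α hα]
    exact Ideal.subset_span ⟨α, hα.1, rfl⟩
  · rintro I ⟨hI, hmem⟩
    rw [forall_specialize_mem_iff] at hmem
    obtain ⟨f', hf', hb', rfl⟩ := exists_markedBasis_of_mem_markedFamily hss hI
    have hext' : ∀ α ∈ superminimals J,
        f' α = map (eval c) (genericFamily J (superminimals J) α) := fun α hα =>
      eq_of_mem_markedFamily hI (hf'.mono (superminimals_subset J))
        ((isMarkedFamily_generic (superminimals_subset J)).map (eval c)) hα
        (Ideal.subset_span ⟨α, hα.1, rfl⟩) (hmem α hα)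
    rw [Set.image_congr (IsMarkedBasis.unique hss hJ hf' hf hb' hb hext' hext)]

theorem existsUnique_zero_of_ideal (hss : IsStronglyStable J)
    (I : Ideal (Poly n K)) (hI : I ∈ markedFamily J) :
    ∃! c : ParamCt J → K, (∀ e ∈ idealAt J, eval c e = 0) ∧
      ∀ F ∈ genericSet J (superminimals J), specialize c F.poly ∈ I := by
  obtain ⟨f, hf, hb, rfl⟩ := exists_markedBasis_of_mem_markedFamily hss hI
  have hgen := isMarkedFamily_generic (superminimals_subset J)
  have hext : ∀ α ∈ superminimals J, f α =
      map (familyHom J (superminimals J) (RingHom.id K) f)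
        (genericFamily J (superminimals J) α) := fun α hα =>
    (map_familyHom (superminimals_subset J) _ (hf.mono (superminimals_subset J)) hα).symm
  refine ⟨fun p => -(f p.1.1).coeff p.1.2,
    ⟨hb.map_eq_zero_of_mem_idealAt hf hext, forall_specialize_mem_iff.2 fun α hα => ?_⟩, ?_⟩
  · have := hext α hα ▸ Ideal.subset_span (s := f '' monomialBasis J) ⟨α, hα.1, rfl⟩
    exact this
  · rintro c ⟨-, hmem⟩
    rw [forall_specialize_mem_iff] at hmem
    have heq : eval c = familyHom J (superminimals J) (RingHom.id K) f := by
      refine hom_ext_of_map_genericFamily (superminimals_subset J) (fun a => ?_) fun α hα γ => ?_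
      · simp [familyHom]
      · rw [← coeff_map, ← coeff_map, ← hext α hα]
        congr 1
        exact eq_of_mem_markedFamily hI (hgen.map (eval c)) (hf.mono (superminimals_subset J)) hα
          (hmem α hα) (Ideal.subset_span ⟨α, hα.1, rfl⟩)
    funext p
    have h1 := RingHom.congr_fun heq (X p)
    rw [eval_X] at h1
    exact h1.trans (familyHom_X _ _ _)

end Points

/-! ### Termination of superminimal reduction and minimality of its exponent. -/

section SuperminimalReduction

variable {n : ℕ} {K : Type*} [Field K] {A : Type*} [CommRing A] {J : Ideal (Poly n K)} {m : ℕ}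
  {f : Exp n → Poly n A}

theorem StronglyReduced.nonReducible {sG : Set (Marked n A)} {h : Poly n A}
    (hh : StronglyReduced J sG h) : NonReducible J sG h := by
  have := hh 0
  rwa [pow_zero, one_mul] at this

theorem StronglyReduced.X_pow_mul {sG : Set (Marked n A)} {h : Poly n A}
    (hh : StronglyReduced J sG h) (s : ℕ) : StronglyReduced J sG (X 0 ^ s * h) := by
  intro t
  rw [← mul_assoc, ← pow_add]
  exact hh _

/-- If `x_0^{t'} H` reduces to a strongly reduced polynomial, then for `t ≥ t'` every
nonreducible polynomial obtained from `x_0^t H` is strongly reduced. -/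
theorem stronglyReduced_of_nonReducible (hJ : IsUnderTruncation m J)
    (hf : IsMarkedFamily J (superminimals J) f) {H P : Poly n A} {t : ℕ}
    (hP : SGReduces J (markedSet (superminimals J) f) (X 0 ^ t * H) P)
    (hn : NonReducible J (markedSet (superminimals J) f) P) {t' : ℕ} (ht : t' ≤ t)
    {R : Poly n A} (hR : IsStrongReduct J (markedSet (superminimals J) f) H t' R) :
    StronglyReduced J (markedSet (superminimals J) f) P := by
  have hS := hf.isSystem_under hJ
  -- `x_0^{t-t'} R` is another irreducible reduct of `x_0^t H`, and irreducible reducts are unique.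
  have hRs := hR.2.X_pow_mul (t - t')
  have h1 := reduces_monomial_mul hS.restr (under_single_zero (t - t')) (sgReduces_iff.1 hR.1)
  rw [← X_zero_pow_eq, ← mul_assoc, ← pow_add, Nat.sub_add_cancel ht] at h1
  have hcoeff : ∀ {Q : Poly n A}, NonReducible J (markedSet (superminimals J) f) Q →
      ∀ q ∈ multiples under (underIdeal J) (superminimals J) f, Q.coeff q.head = 0 :=
    fun hQ q hq => coeff_eq_zero_of_irreducible (fun h₁ hs => hQ h₁ (sgStep_iff.2 hs)) hq
  rw [hS.isRanked.reduces_unique (sgReduces_iff.1 hP) h1 (hcoeff hn) (hcoeff hRs.nonReducible)]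
  exact hRs

/-- The invariant of an execution of `superminimalReduction(H, sG)`. -/
def IsSMRState (J : Ideal (Poly n K)) (sG : Set (Marked n A)) (H : Poly n A) (x : ℕ × Poly n A) :
    Prop :=
  SGReduces J sG (X 0 ^ x.1 * H) x.2 ∧ ∀ t' R, IsStrongReduct J sG H t' R → x.1 ≤ t'

theorem isSMRState_init {sG : Set (Marked n A)} {H : Poly n A} : IsSMRState J sG H (0, H) :=
  ⟨by rw [pow_zero, one_mul]; exact Relation.ReflTransGen.refl, fun _ _ _ => Nat.zero_le _⟩

theorem IsSMRState.step (hJ : IsUnderTruncation m J)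
    (hf : IsMarkedFamily J (superminimals J) f) {H : Poly n A} {x y : ℕ × Poly n A}
    (hx : IsSMRState J (markedSet (superminimals J) f) H x)
    (hs : SMRStep J (markedSet (superminimals J) f) H x y) :
    IsSMRState J (markedSet (superminimals J) f) H y := by
  cases hs with
  | reduce t P P' h => exact ⟨hx.1.tail h, hx.2⟩
  | restart t P h h' =>
    refine ⟨Relation.ReflTransGen.refl, fun t' R hR => ?_⟩
    by_contra hlt
    -- A strong reduct at an exponent `t' ≤ t` would have made the rejected polynomial strongly
    -- reduced.
    exact h' (stronglyReduced_of_nonReducible hJ hf hx.1 h (by simp at hlt; omega) hR)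

theorem IsSMRState.isSuperminimalReduction {sG : Set (Marked n A)} {H P : Poly n A} {t : ℕ}
    (hx : IsSMRState J sG H (t, P)) (hP : StronglyReduced J sG P) :
    IsSuperminimalReduction J sG H t P :=
  ⟨hx.1, hP, fun t' R h h' => hx.2 t' R ⟨h, h'⟩⟩

/-- Let `T` be an exponent that admits a strong reduct. Restarts are impossible at `T`, and for each
fixed exponent the reduction steps are well-founded; the induction is on `T - t`, then on the
polynomial. -/
theorem acc_smrStep (hss : IsStronglyStable J) (hJ : IsUnderTruncation m J)
    (hf : IsMarkedFamily J (superminimals J) f) (H : Poly n A) :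
    Acc (fun y x => SMRStep J (markedSet (superminimals J) f) H x y) (0, H) := by
  obtain ⟨T, R, hR⟩ := exists_isStrongReduct hss hJ hf H
  have key : ∀ k t, t + k = T → ∀ P,
      SGReduces J (markedSet (superminimals J) f) (X 0 ^ t * H) P →
      Acc (fun y x => SMRStep J (markedSet (superminimals J) f) H x y) (t, P) := by
    intro k
    induction k with
    | zero =>
      rintro t rfl P
      induction P using (hf.isSystem_under hJ).isRanked.wellFounded.induction with
      | _ P ih =>
        intro hP
        constructor
        intro y hy
        cases hy with
        | reduce _ _ P' h => exact ih P' (sgStep_iff.1 h) (hP.tail h)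
        | restart _ _ h h' => exact absurd (stronglyReduced_of_nonReducible hJ hf hP h le_rfl hR) h'
    | succ k ihk =>
      intro t ht P
      induction P using (hf.isSystem_under hJ).isRanked.wellFounded.induction with
      | _ P ih =>
        intro hP
        constructor
        intro y hy
        cases hy with
        | reduce _ _ P' h => exact ih P' (sgStep_iff.1 h) (hP.tail h)
        | restart _ _ h h' => exact ihk (t + 1) (by omega) _ Relation.ReflTransGen.refl
  exact key T 0 (Nat.zero_add T) H (by rw [pow_zero, one_mul]; exact Relation.ReflTransGen.refl)

end SuperminimalReduction

/-! ### Termination of the whole algorithm. -/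

section Termination

variable {n : ℕ} {K : Type*} [Field K] {J : Ideal (Poly n K)} {m : ℕ}

theorem acc_smrStep_generic (hss : IsStronglyStable J) (hJ : IsUnderTruncation m J)
    (H : Poly n (Coef J)) :
    Acc (fun y x => SMRStep J (genericSet J (superminimals J)) H x y) (0, H) := by
  rw [genericSet_eq]
  exact acc_smrStep hss hJ (isMarkedFamily_generic (superminimals_subset J)) H

theorem genericSet_superminimals_finite (J : Ideal (Poly n K)) :
    (genericSet J (superminimals J)).Finite := by
  rw [genericSet_eq]
  exact ((monomialBasis_finite J).subset (superminimals_subset J)).image _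

theorem pairsL1_finite (J : Ideal (Poly n K)) :
    (pairsL1 J (genericSet J (superminimals J))).Finite :=
  ((genericSet_superminimals_finite J).prod (genericSet_superminimals_finite J)).subset
    fun _ hp => ⟨hp.1, hp.2.1⟩

theorem acc_callPair {sG : Set (Marked n (Coef J))}
    {todo : Set (Marked n (Coef J) × Marked n (Coef J))}
    {p : Marked n (Coef J) × Marked n (Coef J)}
    (hloop : ∀ Gt eqs, Acc (fun s' s => Step J s s') ⟨Gt, sG, eqs, .loopPairs todo⟩)
    {x : ℕ × Poly n (Coef J)} (hx : Acc (fun y x => SMRStep J sG (sPoly p.1 p.2) x y) x)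
    (Gt : Set (Marked n (Coef J))) (eqs : Set (Coef J)) :
    Acc (fun s' s => Step J s s') ⟨Gt, sG, eqs, .callPair todo p x.1 x.2⟩ := by
  induction hx with
  | intro x _ ih =>
    constructor
    intro s hs
    cases hs with
    | pairWork _ _ _ _ _ _ t' _ P' h => exact ih (t', P') h
    | pairReturn => exact hloop _ _

theorem acc_callGen {sG : Set (Marked n (Coef J))} {todo : Set (Exp n)} {α : Exp n}
    (hloop : ∀ Gt eqs, Acc (fun s' s => Step J s s') ⟨Gt, sG, eqs, .loopGens todo⟩)
    {x : ℕ × Poly n (Coef J)} (hx : Acc (fun y x => SMRStep J sG (monomial α 1) x y) x)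
    (Gt : Set (Marked n (Coef J))) (eqs : Set (Coef J)) :
    Acc (fun s' s => Step J s s') ⟨Gt, sG, eqs, .callGen todo α x.1 x.2⟩ := by
  induction hx with
  | intro x _ ih =>
    constructor
    intro s hs
    cases hs with
    | genWork _ _ _ _ _ _ t' _ P' h => exact ih (t', P') h
    | genReturn => exact hloop _ _

/-- Every call terminates and leaves one pair fewer to process, whatever has accumulated in `Gt` and
`eqs`. -/
theorem acc_loopPairs (hss : IsStronglyStable J) (hJ : IsUnderTruncation m J)
    {todo : Set (Marked n (Coef J) × Marked n (Coef J))} (hfin : todo.Finite)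
    (Gt : Set (Marked n (Coef J))) (eqs : Set (Coef J)) :
    Acc (fun s' s => Step J s s')
      ⟨Gt, genericSet J (superminimals J), eqs, .loopPairs todo⟩ := by
  induction hk : todo.ncard using Nat.strong_induction_on generalizing todo Gt eqs with
  | _ k ih =>
    subst hk
    constructor
    intro s hs
    cases hs with
    | pairCall _ _ _ _ p h =>
      exact acc_callPair (fun Gt eqs => ih _ (Set.ncard_sdiff_singleton_lt_of_mem h hfin)
        (hfin.subset Set.sdiff_subset) Gt eqs rfl) (acc_smrStep_generic hss hJ _) Gt eqs
    | pairsDone => exact ⟨_, fun s hs => by cases hs⟩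

theorem acc_loopGens (hss : IsStronglyStable J) (hJ : IsUnderTruncation m J)
    {todo : Set (Exp n)} (hfin : todo.Finite)
    (Gt : Set (Marked n (Coef J))) (eqs : Set (Coef J)) :
    Acc (fun s' s => Step J s s')
      ⟨Gt, genericSet J (superminimals J), eqs, .loopGens todo⟩ := by
  induction hk : todo.ncard using Nat.strong_induction_on generalizing todo Gt eqs with
  | _ k ih =>
    subst hk
    constructor
    intro s hs
    cases hs with
    | genCall _ _ _ _ α h =>
      exact acc_callGen (fun Gt eqs => ih _ (Set.ncard_sdiff_singleton_lt_of_mem h hfin)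
        (hfin.subset Set.sdiff_subset) Gt eqs rfl) (acc_smrStep_generic hss hJ _) Gt eqs
    | gensDone => exact acc_loopPairs hss hJ (pairsL1_finite J) Gt eqs

/-- The generic polynomials that have been built when the elements of `todo` are left. -/
def builtSet (J : Ideal (Poly n K)) (todo : Set (Exp n)) : Set (Marked n (Coef J)) :=
  {F | ∃ (α : Exp n) (hα : α ∈ superminimals J), α ∉ todo ∧ F = generic J (superminimals J) α hα}

theorem builtSet_empty (J : Ideal (Poly n K)) :
    builtSet J ∅ = genericSet J (superminimals J) := by
  ext F
  simp [builtSet, genericSet]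

theorem builtSet_superminimals (J : Ideal (Poly n K)) : builtSet J (superminimals J) = ∅ := by
  ext F
  simp only [builtSet, Set.mem_ofPred_eq, Set.mem_empty_iff_false, iff_false]
  rintro ⟨α, hα, h, -⟩
  exact h hα

theorem insert_builtSet {todo : Set (Exp n)} {α : Exp n} (hα : α ∈ superminimals J) :
    insert (generic J (superminimals J) α hα) (builtSet J todo) = builtSet J (todo \ {α}) := by
  ext F
  constructor
  · rintro (rfl | ⟨β, hβ, h, rfl⟩)
    · exact ⟨α, hα, fun h => h.2 rfl, rfl⟩
    · exact ⟨β, hβ, fun h' => h h'.1, rfl⟩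
  · rintro ⟨β, hβ, h, rfl⟩
    by_cases he : β = α
    · subst he
      exact Or.inl rfl
    · exact Or.inr ⟨β, hβ, fun h' => h ⟨h', he⟩, rfl⟩

/-- Tying `sG` to `todo` through `builtSet` ensures that the later calls reduce by the whole of
`s𝒢`, for which termination is known. -/
theorem acc_build (hss : IsStronglyStable J) (hJ : IsUnderTruncation m J)
    {todo : Set (Exp n)} (hfin : todo.Finite)
    (Gt : Set (Marked n (Coef J))) (eqs : Set (Coef J)) :
    Acc (fun s' s => Step J s s') ⟨Gt, builtSet J todo, eqs, .build todo⟩ := by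
  induction hk : todo.ncard using Nat.strong_induction_on generalizing todo Gt eqs with
  | _ k ih =>
    subst hk
    constructor
    intro s hs
    cases hs with
    | build _ _ _ _ α hα h =>
      rw [insert_builtSet hα]
      exact ih _ (Set.ncard_sdiff_singleton_lt_of_mem h hfin)
        (hfin.subset Set.sdiff_subset) _ _ rfl
    | buildDone =>
      rw [builtSet_empty]
      exact acc_loopGens hss hJ ((monomialBasis_finite J).subset Set.sdiff_subset) _ _

theorem acc_initState (hss : IsStronglyStable J) (hJ : IsUnderTruncation m J) :
    Acc (fun s' s => Step J s s') (initState J) := by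
  have := acc_build hss hJ ((monomialBasis_finite J).subset (superminimals_subset J)) ∅ ∅
  rwa [builtSet_superminimals] at this

theorem not_exists_infinite_run (hss : IsStronglyStable J) (hJ : IsUnderTruncation m J) :
    ¬ ∃ run : ℕ → State J, run 0 = initState J ∧ ∀ k, Step J (run k) (run (k + 1)) := by
  rintro ⟨run, h0, hrun⟩
  have key : ∀ s, Acc (fun s' s => Step J s s') s → ∀ k, run k ≠ s := by
    intro s hs
    induction hs with
    | intro s _ ih =>
      rintro k rfl
      exact ih _ (hrun k) (k + 1) rfl
  exact key _ (acc_initState hss hJ) 0 h0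

end Termination

/-! ### Loop invariants and correctness of the returned equations. -/

section Invariants

variable {n : ℕ} {K : Type*} [Field K] {J : Ideal (Poly n K)} {m : ℕ}

/-- The equations found while the elements of `todo` are left in the first loop. -/
structure GensInvariant (J : Ideal (Poly n K)) (eqs : Set (Coef J)) (todo : Set (Exp n)) :
    Prop where
  finite : eqs.Finite
  todo_subset : todo ⊆ monomialBasis J \ superminimals J
  sound : eqs ⊆ idealAt J
  gens : ∀ α ∈ monomialBasis J \ superminimals J, α ∉ todo → ∃ t R,
    IsStrongReduct J (genericSet J (superminimals J)) (monomial α 1) t R ∧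
      ∀ c ∈ (R.modMonomial (Finsupp.single 0 t)).coeffs, c ∈ eqs

/-- The equations found while the elements of `todo` are left in the second loop. -/
structure PairsInvariant (J : Ideal (Poly n K)) (eqs : Set (Coef J))
    (todo : Set (Marked n (Coef J) × Marked n (Coef J))) : Prop extends
    GensInvariant J eqs ∅ where
  pairs_subset : todo ⊆ pairsL1 J (genericSet J (superminimals J))
  pairs : ∀ p ∈ pairsL1 J (genericSet J (superminimals J)), p ∉ todo → ∃ t R,
    IsStrongReduct J (genericSet J (superminimals J)) (sPoly p.1 p.2) t R ∧
      ∀ c ∈ R.coeffs, c ∈ eqs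

/-- The invariant of the algorithm. -/
def Invariant (J : Ideal (Poly n K)) (s : State J) : Prop :=
  match s.ctrl with
  | .build todo => s.sG = builtSet J todo ∧ todo ⊆ superminimals J ∧ s.eqs = ∅
  | .loopGens todo => s.sG = genericSet J (superminimals J) ∧ GensInvariant J s.eqs todo
  | .callGen todo α t P => s.sG = genericSet J (superminimals J) ∧
      GensInvariant J s.eqs (insert α todo) ∧
      IsSMRState J (genericSet J (superminimals J)) (monomial α 1) (t, P)
  | .loopPairs todo => s.sG = genericSet J (superminimals J) ∧ PairsInvariant J s.eqs todo
  | .callPair todo p t P => s.sG = genericSet J (superminimals J) ∧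
      PairsInvariant J s.eqs (insert p todo) ∧
      IsSMRState J (genericSet J (superminimals J)) (sPoly p.1 p.2) (t, P)
  | .returned => s.sG = genericSet J (superminimals J) ∧ PairsInvariant J s.eqs ∅

theorem IsSMRState.step_generic (hJ : IsUnderTruncation m J) {H : Poly n (Coef J)}
    {x y : ℕ × Poly n (Coef J)}
    (hx : IsSMRState J (genericSet J (superminimals J)) H x)
    (hs : SMRStep J (genericSet J (superminimals J)) H x y) :
    IsSMRState J (genericSet J (superminimals J)) H y := by
  rw [genericSet_eq] at *
  exact hx.step hJ (isMarkedFamily_generic (superminimals_subset J)) hs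

theorem GensInvariant.insert_return (hss : IsStronglyStable J) (hJ : IsUnderTruncation m J)
    {eqs : Set (Coef J)} {todo : Set (Exp n)} {α : Exp n}
    (h : GensInvariant J eqs (insert α todo)) {t : ℕ} {R : Poly n (Coef J)}
    (hR : IsStrongReduct J (genericSet J (superminimals J)) (monomial α 1) t R) :
    GensInvariant J (eqs ∪ (R.modMonomial (Finsupp.single 0 t)).coeffs) todo where
  finite := h.finite.union (Finset.finite_toSet _)
  todo_subset := (Set.subset_insert _ _).trans h.todo_subset
  sound := Set.union_subset h.sound fun c hc => mem_idealAt_of_strongReduct hss hJ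
    (h.todo_subset (Set.mem_insert _ _)).1 hR c hc
  gens β hβ hn := by
    by_cases he : β = α
    · subst he
      exact ⟨t, R, hR, fun c hc => Or.inr hc⟩
    · obtain ⟨t', R', hR', hc⟩ := h.gens β hβ (fun hm => (Set.mem_insert_iff.1 hm).elim he hn)
      exact ⟨t', R', hR', fun c hc' => Or.inl (hc c hc')⟩

theorem PairsInvariant.insert_return (hss : IsStronglyStable J) (hJ : IsUnderTruncation m J)
    {eqs : Set (Coef J)} {todo : Set (Marked n (Coef J) × Marked n (Coef J))}
    {p : Marked n (Coef J) × Marked n (Coef J)}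
    (h : PairsInvariant J eqs (insert p todo)) {t : ℕ} {R : Poly n (Coef J)}
    (hR : IsStrongReduct J (genericSet J (superminimals J)) (sPoly p.1 p.2) t R) :
    PairsInvariant J (eqs ∪ R.coeffs) todo where
  finite := h.finite.union (Finset.finite_toSet _)
  todo_subset := Set.empty_subset _
  sound := by
    have hp := h.pairs_subset (Set.mem_insert _ _)
    exact Set.union_subset h.sound fun c hc =>
      mem_idealAt_of_strongReduct_sPoly hss hJ hp.1 hp.2.1 hR c hc
  gens β hβ hn := by
    obtain ⟨t', R', hR', hc⟩ := h.gens β hβ hn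
    exact ⟨t', R', hR', fun c hc' => Or.inl (hc c hc')⟩
  pairs_subset := (Set.subset_insert _ _).trans h.pairs_subset
  pairs q hq hn := by
    by_cases he : q = p
    · subst he
      exact ⟨t, R, hR, fun c hc => Or.inr hc⟩
    · obtain ⟨t', R', hR', hc⟩ := h.pairs q hq (fun hm => (Set.mem_insert_iff.1 hm).elim he hn)
      exact ⟨t', R', hR', fun c hc' => Or.inl (hc c hc')⟩

theorem Invariant.step (hss : IsStronglyStable J) (hJ : IsUnderTruncation m J) {s s' : State J}
    (h : Invariant J s) (hs : Step J s s') : Invariant J s' := by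
  cases hs with
  | build Gt sG eqs todo α hα hmem =>
    obtain ⟨rfl, hsub, heqs⟩ := h
    exact ⟨insert_builtSet hα, Set.sdiff_subset.trans hsub, heqs⟩
  | buildDone Gt sG eqs =>
    obtain ⟨hsG, -, heqs⟩ := h
    refine ⟨hsG.trans (builtSet_empty J), ?_⟩
    change eqs = ∅ at heqs
    subst heqs
    exact ⟨Set.finite_empty, subset_rfl, Set.empty_subset _, fun α hα hn => absurd hα hn⟩
  | genCall Gt sG eqs todo α hmem =>
    obtain ⟨hsG, hinv⟩ := h
    refine ⟨hsG, ?_, isSMRState_init⟩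
    rwa [Set.insert_sdiff_singleton, Set.insert_eq_of_mem hmem]
  | genWork Gt sG eqs todo α t t' P P' hstep =>
    obtain ⟨hsG, hinv, hst⟩ := h
    change sG = _ at hsG
    subst hsG
    exact ⟨rfl, hinv, hst.step_generic hJ hstep⟩
  | genReturn Gt sG eqs todo α t H hred =>
    obtain ⟨hsG, hinv, hst⟩ := h
    change sG = _ at hsG
    subst hsG
    exact ⟨rfl, hinv.insert_return hss hJ ⟨hst.1, hred⟩⟩
  | gensDone Gt sG eqs =>
    obtain ⟨hsG, hinv⟩ := h
    change sG = _ at hsG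
    subst hsG
    exact ⟨rfl, ⟨hinv, subset_rfl, fun p hp hn => absurd hp hn⟩⟩
  | pairCall Gt sG eqs todo p hmem =>
    obtain ⟨hsG, hinv⟩ := h
    refine ⟨hsG, ?_, isSMRState_init⟩
    rwa [Set.insert_sdiff_singleton, Set.insert_eq_of_mem hmem]
  | pairWork Gt sG eqs todo p t t' P P' hstep =>
    obtain ⟨hsG, hinv, hst⟩ := h
    change sG = _ at hsG
    subst hsG
    exact ⟨rfl, hinv, hst.step_generic hJ hstep⟩
  | pairReturn Gt sG eqs todo p t H hred =>
    obtain ⟨hsG, hinv, hst⟩ := h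
    change sG = _ at hsG
    subst hsG
    exact ⟨rfl, hinv.insert_return hss hJ ⟨hst.1, hred⟩⟩
  | pairsDone Gt sG eqs => exact h

theorem Reachable.invariant (hss : IsStronglyStable J) (hJ : IsUnderTruncation m J) {s : State J}
    (h : Reachable J s) : Invariant J s := by
  induction h with
  | refl => exact ⟨(builtSet_superminimals J).symm, subset_rfl, rfl⟩
  | tail _ hs ih => exact ih.step hss hJ hs

theorem exists_smrStep {sG : Set (Marked n (Coef J))} {H : Poly n (Coef J)} {t : ℕ}
    {P : Poly n (Coef J)} (hP : ¬ StronglyReduced J sG P) :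
    ∃ t' P', SMRStep J sG H (t, P) (t', P') := by
  by_cases hn : NonReducible J sG P
  · exact ⟨_, _, .restart t P hn hP⟩
  · unfold NonReducible at hn
    push Not at hn
    obtain ⟨P', h⟩ := hn
    exact ⟨_, _, .reduce t P P' h⟩

theorem Invariant.exists_step {s : State J} (h : Invariant J s) (hr : s.ctrl ≠ .returned) :
    ∃ s', Step J s s' := by
  obtain ⟨Gt, sG, eqs, ctrl⟩ := s
  cases ctrl with
  | build todo =>
    rcases todo.eq_empty_or_nonempty with rfl | ⟨α, hα⟩
    · exact ⟨_, .buildDone Gt sG eqs⟩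
    · exact ⟨_, .build Gt sG eqs todo α (h.2.1 hα) hα⟩
  | loopGens todo =>
    rcases todo.eq_empty_or_nonempty with rfl | ⟨α, hα⟩
    · exact ⟨_, .gensDone Gt sG eqs⟩
    · exact ⟨_, .genCall Gt sG eqs todo α hα⟩
  | callGen todo α t P =>
    by_cases hP : StronglyReduced J sG P
    · exact ⟨_, .genReturn Gt sG eqs todo α t P hP⟩
    · obtain ⟨t', P', hs⟩ := exists_smrStep hP
      exact ⟨_, .genWork Gt sG eqs todo α t t' P P' hs⟩
  | loopPairs todo =>
    rcases todo.eq_empty_or_nonempty with rfl | ⟨p, hp⟩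
    · exact ⟨_, .pairsDone Gt sG eqs⟩
    · exact ⟨_, .pairCall Gt sG eqs todo p hp⟩
  | callPair todo p t P =>
    by_cases hP : StronglyReduced J sG P
    · exact ⟨_, .pairReturn Gt sG eqs todo p t P hP⟩
    · obtain ⟨t', P', hs⟩ := exists_smrStep hP
      exact ⟨_, .pairWork Gt sG eqs todo p t t' P P' hs⟩
  | returned => exact absurd rfl hr

/-- The quotient map modulo the returned equations satisfies `KillsEquations` tautologically, so it
kills `𝔄̃_J`. The opposite inclusion is the soundness part of the invariant. -/
theorem PairsInvariant.span_eq (hss : IsStronglyStable J) (hJ : IsUnderTruncation m J)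
    {eqs : Set (Coef J)} (h : PairsInvariant J eqs ∅) : Ideal.span eqs = idealAt J := by
  refine le_antisymm (Ideal.span_le.2 h.sound) fun e he => ?_
  have hk : KillsEquations J (Ideal.Quotient.mk (Ideal.span eqs)) :=
    { gens := fun α hα => by
        obtain ⟨t, R, hR, hc⟩ := h.gens α hα (Set.notMem_empty _)
        exact ⟨t, R, hR, fun c hc' =>
          Ideal.Quotient.eq_zero_iff_mem.2 (Ideal.subset_span (hc c hc'))⟩
      pairs := fun p hp => by
        obtain ⟨t, R, hR, hc⟩ := h.pairs p hp (Set.notMem_empty _)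
        exact ⟨t, R, hR, fun c hc' =>
          Ideal.Quotient.eq_zero_iff_mem.2 (Ideal.subset_span (hc c hc'))⟩ }
  exact Ideal.Quotient.eq_zero_iff_mem.1 (hk.map_eq_zero_of_mem_idealAt hss hJ e he)

end Invariants

end MarkedScheme

end

open MarkedScheme

theorem mainTheorem11 {K : Type*} [Field K] {n : ℕ} (m : ℕ)
    (J : Ideal (MvPolynomial (Fin (n + 1)) K))
    (hmon : IsMonomialIdeal J) (hss : IsStronglyStable J) (htr : IsTruncation m J) :
    -- termination: there is no infinite run, and a run can only stop by returning
    (¬ ∃ run : ℕ → State J, run 0 = initState J ∧ ∀ k, Step J (run k) (run (k + 1))) ∧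
    (∀ s, Reachable J s → s.ctrl ≠ .returned → ∃ s', Step J s s') ∧
    -- the calls of superminimal reduction end with the prescribed values
    (∀ Gt sG eqs todo α t H, Reachable J ⟨Gt, sG, eqs, .callGen todo α t H⟩ →
      StronglyReduced J sG H → IsSuperminimalReduction J sG (monomial α 1) t H) ∧
    (∀ Gt sG eqs todo p t H, Reachable J ⟨Gt, sG, eqs, .callPair todo p t H⟩ →
      StronglyReduced J sG H → IsSuperminimalReduction J sG (sPoly p.1 p.2) t H) ∧
    -- whatever is returned is a finite set of generators of the ideal that defines `Mf(J)`
    (∀ Gt sG eqs, Reachable J ⟨Gt, sG, eqs, .returned⟩ →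
      eqs.Finite ∧ Ideal.span eqs = idealAt J) ∧
    -- the scheme defined by `idealAt J` is the one defined by `idealA J`, via projection
    Function.Surjective
      ((Ideal.Quotient.mk (idealA J)).comp (inclRing J : Coef J →+* MvPolynomial (ParamC J) K)) ∧
    -- its `K`-points correspond one-to-one to the ideals of `Mf(J)`
    (∀ c : ParamCt J → K, (∀ e ∈ idealAt J, MvPolynomial.eval c e = 0) →
      ∃! I : Ideal (MvPolynomial (Fin (n + 1)) K), I ∈ markedFamily J ∧
        ∀ F ∈ genericSet J (superminimals J), specialize c F.poly ∈ I) ∧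
    (∀ I ∈ markedFamily J, ∃! c : ParamCt J → K,
      (∀ e ∈ idealAt J, MvPolynomial.eval c e = 0) ∧
        ∀ F ∈ genericSet J (superminimals J), specialize c F.poly ∈ I) := by
  have hJ : IsUnderTruncation m J := mem_iff_of_isTruncation hss htr
  refine ⟨not_exists_infinite_run hss hJ, fun s hs => (hs.invariant hss hJ).exists_step, ?_, ?_,
    ?_, toQuotient_surjective hss hJ, existsUnique_ideal_of_zero hss hJ,
    existsUnique_zero_of_ideal hss⟩
  · intro Gt sG eqs todo α t H hs hred
    obtain ⟨hsG, -, hst⟩ := hs.invariant hss hJ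
    change sG = _ at hsG
    subst hsG
    exact hst.isSuperminimalReduction hred
  · intro Gt sG eqs todo p t H hs hred
    obtain ⟨hsG, -, hst⟩ := hs.invariant hss hJ
    change sG = _ at hsG
    subst hsG
    exact hst.isSuperminimalReduction hred
  · intro Gt sG eqs hs
    obtain ⟨-, hinv⟩ := hs.invariant hss hJ
    exact ⟨hinv.finite, hinv.span_eq hss hJ⟩
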